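/- Let $\Sigma$ be a smooth surface with a conformal structure $c$ of signature $(1,1)$ and Hodge star $*$ on $1$-forms ($*^2=1$); null coordinates $(\xi,\eta)$ are labelled so that $*d\xi=d\xi$, $*d\eta=-d\eta$. A smooth map $N:(\Sigma,c)\to S^2\subset\mathbb{R}^3$ is harmonic if the tangential part of $d{*}dN$ vanishes, equivalently $d(N\times *dN)=0$. Identify $\mathbb{R}^3\cong\mathfrak{so}(3)$ and $\mathbb{C}^3\cong\mathfrak{so}(3,\mathbb{C})$ by $v\mapsto(u\mapsto v\times u)$, put $\mathcal N=N\times dN$, $\mathcal D=d-\mathcal N$, $\mathcal N^{\pm}=\tfrac12(\mathcal N\pm *\mathcal N)$ and, for $\lambda\in\mathbb{C}^\times$, $d_\lambda=\mathcal D+\lambda\mathcal N^++\lambda^{-1}\mathcal N^-$, a connection on $\Sigma\times\mathbb{C}^3$. A trivialising gauge of $d_\lambda$ is a smooth $T_\lambda:\Sigma\to \mathrm{SO}(3,\mathbb{C})$ with $T_\lambda\circ d_\lambda=d\circ T_\lambda$. **Theorem.** Let $N:(\Sigma,c)\to S^2$ be harmonic, let $\mu\in\mathbb{R}\setminus\{0\}$,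 let $T_\mu:\Sigma\to\mathrm{SO}(3)$ be a (real) trivialising gauge of $d_\mu$, and put $N^\mu:=T_\mu N$. 1. $N^\mu:(\Sigma,c)\to S^2$ is harmonic. Hence near every point there is a smooth $f^\mu$ with $df^\mu=N^\mu\times *dN^\mu$. On every open set on which such an $f^\mu$ is defined and $N$ is an immersion, $f^\mu$ is an immersion with Gauss map $N^\mu$ and constant Gauss curvature $K=-1$ (a $K$-surface), and its second fundamental form is, at each point, a non-zero multiple of the metrics in $c$. 2. Let $f,f^\mu$ be smooth maps on an open set $V$ with $df=N\times *dN$ and $df^\mu=N^\mu\times *dN^\mu$, and let $(\xi,\eta)$ be null coordinates on an open subset of $V$ that are Tchebyshev for $f$ (asymptotic, with $|f_\xi|=|f_\eta|=1$), so that $I_f=d\xi^2+2\cos\omega\,d\xi d\eta+d\eta^2$. Then $$I_{f^\mu}=\mu^2d\xi^2+2\cos\omega\,d\xi d\eta+\mu^{-2}d\eta^2 .$$ If moreover $N$ is an immersion there and $\omega$ is smooth, then $f^\mu$ is a Lie transform of $f$: $\hat\xi=\mu\xi$, $\hat\eta=\mu^{-1}\eta$ are Tchebyshev coordinates for the $K$-surface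 $f^\mu$ (with $K=-1$), in which $I_{f^\mu}=d\hat\xi^2+2\cos\omega^\mu\,d\hat\xi d\hat\eta+d\hat\eta^2$, where $\omega^\mu(\hat\xi,\hat\eta)=\omega(\mu^{-1}\hat\xi,\mu\hat\eta)$ solves the sine-Gordon equation $\omega^\mu_{\hat\xi\hat\eta}=\sin\omega^\mu$. 3. (Sym formula) Suppose $T_\mu$ is the value at $\lambda=\mu$ of a family of trivialising gauges $T_\lambda$ of $d_\lambda$, for $\lambda\in\mathbb{C}$ near $\mu$, that depends smoothly on $(\lambda,x)$, is holomorphic in $\lambda$ at $\mu$, and is real for real $\lambda$. Then $\mu\,\frac{\partial T_\lambda}{\partial\lambda}\big|_{\lambda=\mu}T_\mu^{-1}$ takes values in $\mathfrak{so}(3)\cong\mathbb{R}^3$ and, as a smooth map $F:\Sigma\to\mathbb{R}^3$, satisfies $dF=N^\mu\times *dN^\mu$; so on every connected open set any $f^\mu$ as in 1 is equal to $F$ up to a translation. -/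

import Mathlib

open scoped Manifold ContDiff Matrix Topology

noncomputable section

namespace KSurf

/-- The model plane, with coordinates `(ξ, η)`. -/
abbrev Plane : Type := ℝ × ℝ

/-- Vectors of `ℝ³`.  Lengths and angles are always expressed through the dot product `⬝ᵥ`
(the norm that Mathlib puts on this type only serves to define smoothness). -/
abbrev R3 : Type := Fin 3 → ℝ

/-- Vectors of `ℂ³`, with the complex bilinear dot and cross products. -/
abbrev C3 : Type := Fin 3 → ℂ

/-- Inclusion `ℝ³ ⊆ ℂ³`. -/
def toC (v : R3) : C3 := fun i => (v i : ℂ)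

section Surfaces

variable {M : Type*} [TopologicalSpace M] [ChartedSpace Plane M]

/-- Matrix (in the coordinates given by the chart `e`) of a field of endomorphisms of the tangent
spaces. -/
def coordEndo (J : ∀ x : M, TangentSpace 𝓘(ℝ, Plane) x →L[ℝ] TangentSpace 𝓘(ℝ, Plane) x)
    (e : OpenPartialHomeomorph M Plane) (y : Plane) : Plane →L[ℝ] Plane :=
  (mfderiv 𝓘(ℝ, Plane) 𝓘(ℝ, Plane) e (e.symm y)).comp
    ((J (e.symm y)).comp (mfderiv 𝓘(ℝ, Plane) 𝓘(ℝ, Plane) e.symm y))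

variable (M) in
/-- A conformal structure of signature `(1,1)` on a surface, given by a smooth representative metric
`g`, together with its Hodge star on 1-forms, written as `*α = α ∘ J`.
For a given conformal class the field `J` is determined up to sign by `J² = 1` and skewness; the
choice of sign is the choice of an orientation. -/
structure LorentzConformalStructure where
  g : ∀ x : M, TangentSpace 𝓘(ℝ, Plane) x →L[ℝ] TangentSpace 𝓘(ℝ, Plane) x →L[ℝ] ℝ
  g_symm : ∀ x X Y, g x X Y = g x Y X
  g_pos : ∀ x, ∃ X, 0 < g x X X
  g_neg : ∀ x, ∃ X, g x X X < 0
  g_smooth : ∀ e ∈ IsManifold.maximalAtlas 𝓘(ℝ, Plane) ∞ M, ∀ v w : Plane,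
    ContDiffOn ℝ ∞ (fun y : Plane => g (e.symm y)
      (mfderiv 𝓘(ℝ, Plane) 𝓘(ℝ, Plane) e.symm y v)
      (mfderiv 𝓘(ℝ, Plane) 𝓘(ℝ, Plane) e.symm y w)) e.target
  J : ∀ x : M, TangentSpace 𝓘(ℝ, Plane) x →L[ℝ] TangentSpace 𝓘(ℝ, Plane) x
  J_sq : ∀ x X, J x (J x X) = X
  J_skew : ∀ x X Y, g x (J x X) Y = -g x X (J x Y)
  J_smooth : ∀ e ∈ IsManifold.maximalAtlas 𝓘(ℝ, Plane) ∞ M, ∀ v : Plane,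
    ContDiffOn ℝ ∞ (fun y => coordEndo J e y v) e.target

/-- The differential of a map `Σ → ℝ³`. -/
def d (f : M → R3) (x : M) : TangentSpace 𝓘(ℝ, Plane) x →L[ℝ] R3 :=
  mfderiv 𝓘(ℝ, Plane) 𝓘(ℝ, R3) f x

/-- The trivial connection on sections of the trivial `ℂ³`-bundle. -/
def dC (σ : M → C3) (x : M) : TangentSpace 𝓘(ℝ, Plane) x →L[ℝ] C3 :=
  mfderiv 𝓘(ℝ, Plane) 𝓘(ℝ, C3) σ x

/-- The component along `dξ ∧ dη` of the `ℝ³`-valued 2-form `d(*dN)`, in the chart `e = (ξ, η)`. -/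
def dStarD (c : LorentzConformalStructure M) (N : M → R3)
    (e : OpenPartialHomeomorph M Plane) (y : Plane) : R3 :=
  fderiv ℝ (fun z => fderiv ℝ (N ∘ e.symm) z (coordEndo c.J e z (0, 1))) y (1, 0)
    - fderiv ℝ (fun z => fderiv ℝ (N ∘ e.symm) z (coordEndo c.J e z (1, 0))) y (0, 1)

/-- `N : (Σ, c) → S²` is a smooth harmonic map: `d(*dN)` has no component tangent to the sphere. -/
structure IsHarmonic (c : LorentzConformalStructure M) (N : M → R3) : Prop where
  smooth : ContMDiff 𝓘(ℝ, Plane) 𝓘(ℝ, R3) ∞ N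
  unit : ∀ x, N x ⬝ᵥ N x = 1
  tension : ∀ e ∈ IsManifold.maximalAtlas 𝓘(ℝ, Plane) ∞ M, ∀ y ∈ e.target,
    N (e.symm y) ⨯₃ dStarD c N e y = 0

/-! ### Immersed surfaces -/

/-- First fundamental form `I = df · df`. -/
def firstForm (f : M → R3) (x : M) (X Y : TangentSpace 𝓘(ℝ, Plane) x) : ℝ :=
  d f x X ⬝ᵥ d f x Y

/-- Second fundamental form `II = -df · dN`. -/
def secondForm (f N : M → R3) (x : M) (X Y : TangentSpace 𝓘(ℝ, Plane) x) : ℝ :=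
  -(d f x X ⬝ᵥ d N x Y)

/-- On `V`, the map `f` is a smooth immersion with Gauss map `N`. -/
structure IsImmersionWithGaussMapOn (V : Set M) (f N : M → R3) : Prop where
  smooth : ContMDiffOn 𝓘(ℝ, Plane) 𝓘(ℝ, R3) ∞ f V
  smooth_gauss : ContMDiffOn 𝓘(ℝ, Plane) 𝓘(ℝ, R3) ∞ N V
  immersion : ∀ x ∈ V, Function.Injective (d f x)
  unit : ∀ x ∈ V, N x ⬝ᵥ N x = 1
  normal : ∀ x ∈ V, ∀ X, N x ⬝ᵥ d f x X = 0

/-- The Gauss curvature of `f` at `x` is `K`: the determinant of the shape operator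
`S = -(df)⁻¹ ∘ dN`, which is unique where `f` is an immersion. -/
def HasGaussCurvatureAt (f N : M → R3) (x : M) (K : ℝ) : Prop :=
  ∃ S : TangentSpace 𝓘(ℝ, Plane) x →ₗ[ℝ] TangentSpace 𝓘(ℝ, Plane) x,
    (∀ X, d f x (S X) = -d N x X) ∧ LinearMap.det S = K

/-- On `V`, `f` is a `K`-surface with Gauss map `N` and constant negative Gauss curvature `K`. -/
structure IsKSurfaceOn (V : Set M) (f N : M → R3) (K : ℝ) : Prop where
  neg : K < 0
  immersed : IsImmersionWithGaussMapOn V f N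
  curvature : ∀ x ∈ V, HasGaussCurvatureAt f N x K

/-- `df = N × *dN` on `V`. -/
structure IsLelieuvreOn (c : LorentzConformalStructure M) (N : M → R3) (V : Set M)
    (f : M → R3) : Prop where
  smooth : ContMDiffOn 𝓘(ℝ, Plane) 𝓘(ℝ, R3) ∞ f V
  eq : ∀ x ∈ V, ∀ X, d f x X = N x ⨯₃ d N x (c.J x X)

/-! ### The family of connections -/

/-- The 1-form `𝒩`, with values in `so(3) ⊆ so(3, ℂ)`, of the splitting `d = 𝒟 + 𝒩` induced by
`ℝ³ = ⟨N⟩ ⊕ N^⊥`; under `v ↦ (u ↦ v × u)` it is `N × dN`. -/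
def calN (N : M → R3) (x : M) (X : TangentSpace 𝓘(ℝ, Plane) x) (u : C3) : C3 :=
  toC (N x ⨯₃ d N x X) ⨯₃ u

/-- `𝒩⁺ = (𝒩 + *𝒩)/2`. -/
def calNPlus (c : LorentzConformalStructure M) (N : M → R3) (x : M)
    (X : TangentSpace 𝓘(ℝ, Plane) x) (u : C3) : C3 :=
  (1 / 2 : ℂ) • (calN N x X u + calN N x (c.J x X) u)

/-- `𝒩⁻ = (𝒩 - *𝒩)/2`. -/
def calNMinus (c : LorentzConformalStructure M) (N : M → R3) (x : M)
    (X : TangentSpace 𝓘(ℝ, Plane) x) (u : C3) : C3 :=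
  (1 / 2 : ℂ) • (calN N x X u - calN N x (c.J x X) u)

/-- The connection `𝒟 = d - 𝒩`, on sections of the trivial `ℂ³`-bundle. -/
def calD (N : M → R3) (σ : M → C3) (x : M) (X : TangentSpace 𝓘(ℝ, Plane) x) : C3 :=
  dC σ x X - calN N x X (σ x)

/-- The connection `d_l = 𝒟 + l 𝒩⁺ + l⁻¹ 𝒩⁻`. -/
def dLam (c : LorentzConformalStructure M) (N : M → R3) (l : ℂ) (σ : M → C3) (x : M)
    (X : TangentSpace 𝓘(ℝ, Plane) x) : C3 :=
  calD N σ x X + l • calNPlus c N x X (σ x) + l⁻¹ • calNMinus c N x X (σ x)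

/-- `T : Σ → SO(3, ℂ)` is a trivialising gauge of `d_l`: `T ∘ d_l = d ∘ T` on sections. -/
structure IsTrivialisingGauge (c : LorentzConformalStructure M) (N : M → R3) (l : ℂ)
    (T : M → Matrix (Fin 3) (Fin 3) ℂ) : Prop where
  smooth : ∀ i j, ContMDiff 𝓘(ℝ, Plane) 𝓘(ℝ, ℂ) ∞ (fun x => T x i j)
  orth : ∀ x, T x * (T x)ᵀ = 1
  det : ∀ x, (T x).det = 1
  gauge : ∀ σ : M → C3, ContMDiff 𝓘(ℝ, Plane) 𝓘(ℝ, C3) ∞ σ → ∀ x X,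
    T x *ᵥ dLam c N l σ x X = dC (fun y => T y *ᵥ σ y) x X

/-- A family `l ↦ T_l` of trivialising gauges of `d_l`, defined for `l` near the real number `μ`,
smooth in all variables, holomorphic in `l` at `μ`, and real for real `l`. -/
structure IsGaugeFamilyNear (c : LorentzConformalStructure M) (N : M → R3) (μ : ℝ)
    (T : ℂ → M → Matrix (Fin 3) (Fin 3) ℂ) : Prop where
  gauge : ∀ᶠ l in 𝓝 (μ : ℂ), IsTrivialisingGauge c N l (T l)
  smooth : ∀ x i j, ContMDiffAt (𝓘(ℝ, ℂ).prod 𝓘(ℝ, Plane)) 𝓘(ℝ, ℂ) ∞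
    (fun p : ℂ × M => T p.1 p.2 i j) ((μ : ℂ), x)
  holo : ∀ x i j, DifferentiableAt ℂ (fun l => T l x i j) (μ : ℂ)
  real : ∀ᶠ s : ℝ in 𝓝 μ, ∀ x i j, (T (s : ℂ) x i j).im = 0

/-- `μ (∂T_l/∂l)|_{l = μ} T_μ⁻¹`. -/
def symMatrix (μ : ℝ) (T : ℂ → M → Matrix (Fin 3) (Fin 3) ℂ) (x : M) :
    Matrix (Fin 3) (Fin 3) ℂ :=
  (μ : ℂ) • (Matrix.of (fun i j => deriv (fun l => T l x i j) (μ : ℂ)) * (T (μ : ℂ) x)⁻¹)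

/-- `e = (ξ, η)` is a chart of null coordinates of `c`, labelled so that `*dξ = dξ`,
`*dη = -dη`. -/
def IsNullChart (c : LorentzConformalStructure M) (e : OpenPartialHomeomorph M Plane) : Prop :=
  e ∈ IsManifold.maximalAtlas 𝓘(ℝ, Plane) ∞ M ∧
    ∀ y ∈ e.target, coordEndo c.J e y (1, 0) = (1, 0) ∧ coordEndo c.J e y (0, 1) = -(0, 1)

end Surfaces

/-! ### Surfaces in coordinates -/

/-- The coordinates of the plane are Tchebyshev on `U` for the surface `f` with Gauss map `N`:
they are asymptotic, with coordinate vectors of unit length. -/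
structure IsTchebyshevOn (U : Set Plane) (f N : Plane → R3) : Prop where
  asymp_fst : ∀ y ∈ U, d N y (1, 0) ⬝ᵥ d f y (1, 0) = 0
  asymp_snd : ∀ y ∈ U, d N y (0, 1) ⬝ᵥ d f y (0, 1) = 0
  unit_fst : ∀ y ∈ U, d f y (1, 0) ⬝ᵥ d f y (1, 0) = 1
  unit_snd : ∀ y ∈ U, d f y (0, 1) ⬝ᵥ d f y (0, 1) = 1

/-- `I_f = A dξ² + 2 cos ω dξ dη + B dη²` on `U`. -/
def HasFirstFormOn (U : Set Plane) (f : Plane → R3) (A : ℝ) (om : Plane → ℝ) (B : ℝ) : Prop :=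
  ∀ y ∈ U, ∀ a b : ℝ,
    firstForm f y (a, b) (a, b) = A * a ^ 2 + 2 * Real.cos (om y) * a * b + B * b ^ 2

/-- The sine-Gordon equation `ω_{ξη} = -K sin ω` on `U` (that is, `ρ⁻² sin ω` for `K = -ρ⁻²`). -/
def SineGordonOn (U : Set Plane) (K : ℝ) (om : Plane → ℝ) : Prop :=
  ContDiffOn ℝ ∞ om U ∧
    ∀ y ∈ U, fderiv ℝ (fun z => fderiv ℝ om z (1, 0)) y (0, 1) = -K * Real.sin (om y)

/-- `(ξ, η) ↦ (μ⁻¹ ξ, μ η)`. -/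
def lieScale (μ : ℝ) (p : Plane) : Plane := (μ⁻¹ * p.1, μ * p.2)

/-- `fμ`, with Gauss map `Nμ`, is a Lie transform, with parameter `μ`, of a surface of curvature `K`
that is parametrised on `U` by Tchebyshev coordinates with angle `ω`: it is a surface of the same
curvature, parametrised by Tchebyshev coordinates on the rescaled domain, whose angle is the
solution `ω^μ(ξ, η) = ω(μ⁻¹ ξ, μ η)` of the sine-Gordon equation. -/
structure IsLieTransform (μ : ℝ) (U : Set Plane) (K : ℝ) (om : Plane → ℝ)
    (fμ Nμ : Plane → R3) : Prop where
  ksurface : IsKSurfaceOn (lieScale μ ⁻¹' U) fμ Nμ K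
  tchebyshev : IsTchebyshevOn (lieScale μ ⁻¹' U) fμ Nμ
  angle : HasFirstFormOn (lieScale μ ⁻¹' U) fμ 1 (om ∘ lieScale μ) 1
  sineGordon : SineGordonOn (lieScale μ ⁻¹' U) K (om ∘ lieScale μ)

end KSurf

end

/-! Write `a = N × dN`, `b = N × *dN`, and let `J` be the endomorphism with `*α = α ∘ J`. On real
sections `d_μ = d + A ×` with `A = -a + (μ/2)(a + b) + (1/(2μ))(a - b)`, a vector orthogonal to `N`,
and the gauge condition says `dT = T (A ×)`. Everything follows from this equation; flatness of
`d_μ` plays no separate role, because `T` is given.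

Applied to `N` it yields `dN^μ = T dN ∘ (C + S J)` with `C = (μ + μ⁻¹)/2`, `S = (μ - μ⁻¹)/2`
(`d_transform`). This is invertible since `J² = 1` and `C² - S² = 1`. In null coordinates it
multiplies the `ξ`-derivative by `μ`, the `η`-derivative by `μ⁻¹`, and then rotates by `T`.
Differentiating `*dN^μ` once more gives `T` applied to `C d*dN`, a mixed-partials term that cancels,
and cross products of `A` with tangent vectors. The last are parallel to `N`, so harmonicity
persists (`isHarmonic_transform`).

For a harmonic map the form `N × *dN` is closed, so the Poincaré lemma integrates it to some `f`.
Where `N` is an immersion, let `R` be the pullback by `dN` of the quarter turn in the plane `N^⊥`.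
Then `S = J R` is the shape operator of `f` and has determinant `-1 · 1` (`exists_shape_operator`).
The second fundamental form composed with `J`, and likewise `g` composed with `J`, are alternating
forms on a plane, hence proportional (`exists_conformal_factor`).

In null coordinates `f_ξ = N × N_ξ` and `f_η = -N × N_η`, so `f^μ_ξ = μ T f_ξ` and `f^μ_η = μ⁻¹ T
f_η`. Since `T` is orthogonal this gives the first fundamental form, and rescaling the coordinates
restores unit lengths. The sine-Gordon equation is the compatibility condition of the frame of `N`
(`sineGordon_of_harmonic`).

For Sym's formula, differentiate `dT = T (A ×)` in the parameter. The undifferentiated `A` cancels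
by skewness, which leaves `d(∂T Tᵀ) = T (∂A ×) Tᵀ = (T ∂A) ×`, and `μ T ∂A = N^μ × *dN^μ`. -/

namespace KSurf

/-! ### Rotations and cross products in `ℝ³`; involutions and forms on the plane. -/

section LinearAlgebra

/-- Cofactor identity: `Tᵀ (Tu × Tv) = det T · (u × v)` for every matrix; orthogonality then inverts
`Tᵀ`. -/
theorem mulVec_cross {T : Matrix (Fin 3) (Fin 3) ℝ} (h : T * Tᵀ = 1) (hd : T.det = 1)
    (u v : R3) : (T *ᵥ u) ⨯₃ (T *ᵥ v) = T *ᵥ (u ⨯₃ v) := by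
  have key : Tᵀ *ᵥ ((T *ᵥ u) ⨯₃ (T *ᵥ v)) = T.det • (u ⨯₃ v) := by
    ext i
    fin_cases i <;>
      simp [Matrix.mulVec, dotProduct, cross_apply, Fin.sum_univ_three, Matrix.det_fin_three] <;>
      ring
  rw [hd, one_smul] at key
  rw [← key, Matrix.mulVec_mulVec, h, Matrix.one_mulVec]

theorem mulVec_dot_mulVec {T : Matrix (Fin 3) (Fin 3) ℝ} (h : T * Tᵀ = 1)
    (u v : R3) : (T *ᵥ u) ⬝ᵥ (T *ᵥ v) = u ⬝ᵥ v := by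
  rw [Matrix.dotProduct_mulVec, Matrix.vecMul_mulVec, mul_eq_one_comm.mp h, Matrix.vecMul_one]

theorem eq_zero_of_dot_self {v : R3} (h : v ⬝ᵥ v = 0) : v = 0 :=
  dotProduct_self_eq_zero.mp h

theorem cross_cross_of_orthogonal {n v : R3} (hn : n ⬝ᵥ n = 1) (hv : n ⬝ᵥ v = 0) :
    n ⨯₃ (n ⨯₃ v) = -v := by
  rw [cross_cross_eq_smul_sub_smul', hn, hv]; simp

theorem cross_cross_of_orthogonal_left {n v : R3} (hn : n ⬝ᵥ n = 1) (hv : n ⬝ᵥ v = 0) :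
    (n ⨯₃ v) ⨯₃ n = v := by
  rw [← cross_anticomm, cross_cross_of_orthogonal hn hv, neg_neg]

theorem cross_dot_cross_of_orthogonal {n u v : R3} (hn : n ⬝ᵥ n = 1) (hv : n ⬝ᵥ v = 0) :
    (n ⨯₃ u) ⬝ᵥ (n ⨯₃ v) = u ⬝ᵥ v := by
  rw [cross_dot_cross, hn, hv]; simp

theorem eq_smul_of_cross_eq_zero {n v : R3} (hn : n ⬝ᵥ n = 1) (hv : n ⨯₃ v = 0) :
    v = (n ⬝ᵥ v) • n := by
  have := cross_cross_eq_smul_sub_smul' n n v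
  rw [hv, hn, map_zero, one_smul] at this
  exact (sub_eq_zero.mp this.symm).symm

/-- Two vectors orthogonal to a given vector `n` have cross product parallel to `n`. -/
theorem cross_cross_eq_zero {n a b : R3} (ha : n ⬝ᵥ a = 0) (hb : n ⬝ᵥ b = 0) :
    n ⨯₃ (a ⨯₃ b) = 0 := by
  rw [cross_cross_eq_smul_sub_smul', hb, dotProduct_comm a n, ha]; simp

theorem apply_eq_add {E : Type*} [AddCommGroup E] [Module ℝ E] (D : Plane →ₗ[ℝ] E) (X : Plane) :
    D X = X.1 • D (1, 0) + X.2 • D (0, 1) := by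
  rw [← map_smul, ← map_smul, ← map_add]; congr 1; ext <;> simp

theorem det_plane (S : Plane →ₗ[ℝ] Plane) :
    LinearMap.det S = (S (1, 0)).1 * (S (0, 1)).2 - (S (0, 1)).1 * (S (1, 0)).2 := by
  rw [← LinearMap.det_toMatrix (Module.Basis.finTwoProd ℝ), Matrix.det_fin_two]
  simp [LinearMap.toMatrix_apply]

/-- The endomorphism of the plane with given images of the coordinate vectors. -/
noncomputable def planeMap (u v : Plane) : Plane →ₗ[ℝ] Plane :=
  (LinearMap.fst ℝ ℝ ℝ).smulRight u + (LinearMap.snd ℝ ℝ ℝ).smulRight v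

theorem planeMap_apply (u v X : Plane) : planeMap u v X = X.1 • u + X.2 • v := rfl

/-- A non-scalar involution of the plane has trace zero. -/
theorem trace_eq_zero_of_involution (J : Plane →ₗ[ℝ] Plane) (h : ∀ X, J (J X) = X)
    (h1 : ∃ X, J X ≠ X) (h2 : ∃ X, J X ≠ -X) : (J (1, 0)).1 + (J (0, 1)).2 = 0 := by
  have e1 := h (1, 0)
  have e2 := h (0, 1)
  rw [apply_eq_add J (J (1, 0))] at e1
  rw [apply_eq_add J (J (0, 1))] at e2
  rcases hp : J (1, 0) with ⟨p, r⟩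
  rcases hq : J (0, 1) with ⟨q, s⟩
  rw [hp, hq] at e1 e2
  simp only [Prod.smul_mk, Prod.mk_add_mk, Prod.mk.injEq, smul_eq_mul] at e1 e2 ⊢
  by_contra hne
  -- If the trace `p + s` were non-zero, the off-diagonal entries of `J² = 1` would make `J`
  -- diagonal, and the diagonal ones would give `p = s = ±1`, a scalar.
  have hr : r = 0 := by
    have : (p + s) * r = 0 := by linarith [e1.2]
    exact (mul_eq_zero.mp this).resolve_left hne
  have hq0 : q = 0 := by
    have : (p + s) * q = 0 := by linarith [e2.1]
    exact (mul_eq_zero.mp this).resolve_left hne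
  subst hr hq0
  have hps : p = s := by
    have : (p + s) * (p - s) = 0 := by linarith [e1.1, e2.2]
    linarith [(mul_eq_zero.mp this).resolve_left hne]
  subst hps
  have hpp : (p - 1) * (p + 1) = 0 := by linarith [e1.1]
  have hJ : ∀ X, J X = p • X := by
    intro X; rw [apply_eq_add J, hp, hq]; ext <;> simp [mul_comm]
  rcases mul_eq_zero.mp hpp with h' | h'
  · obtain ⟨X, hX⟩ := h1
    exact hX (by rw [hJ, show p = 1 by linarith, one_smul])
  · obtain ⟨X, hX⟩ := h2
    exact hX (by rw [hJ, show p = -1 by linarith, neg_smul, one_smul])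

theorem det_eq_neg_one_of_involution (J : Plane →ₗ[ℝ] Plane) (h : ∀ X, J (J X) = X)
    (ht : (J (1, 0)).1 + (J (0, 1)).2 = 0) : LinearMap.det J = -1 := by
  have e1 := congrArg Prod.fst (h (1, 0))
  rw [apply_eq_add J (J (1, 0))] at e1
  simp only [Prod.fst_add, Prod.smul_fst, smul_eq_mul] at e1
  rw [det_plane]
  have : (J (0, 1)).2 = -(J (1, 0)).1 := by linarith
  rw [this]; linarith

variable {n : R3} {D : Plane →ₗ[ℝ] R3}

theorem cross_eq_smul_normal (hn : n ⬝ᵥ n = 1) (hD : ∀ X, n ⬝ᵥ D X = 0) (X Y : Plane) :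
    D X ⨯₃ D Y = (n ⬝ᵥ (D X ⨯₃ D Y)) • n :=
  eq_smul_of_cross_eq_zero hn (cross_cross_eq_zero (hD X) (hD Y))

/-- The area form of an injective map into the plane orthogonal to `n` does not vanish. -/
theorem area_ne_zero (hn : n ⬝ᵥ n = 1) (hD : ∀ X, n ⬝ᵥ D X = 0) (hinj : Function.Injective D) :
    n ⬝ᵥ (D (1, 0) ⨯₃ D (0, 1)) ≠ 0 := by
  intro h0
  have h1 := cross_eq_smul_normal hn hD (1, 0) (0, 1)
  rw [h0, zero_smul] at h1
  have h2 := cross_cross_eq_smul_sub_smul (D (1, 0)) (D (0, 1)) (D (1, 0))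
  rw [h1, map_zero, LinearMap.zero_apply] at h2
  -- With `a × b = 0`, the triple product `(a × b) × a` is a vanishing combination of `a = D (1, 0)`
  -- and `b = D (0, 1)` with coefficient `a · a` at `b`; injectivity forces `a = 0`, which
  -- injectivity also excludes.
  have h3 : D (-(D (0, 1) ⬝ᵥ D (1, 0)), D (1, 0) ⬝ᵥ D (1, 0)) = D 0 := by
    rw [apply_eq_add D, map_zero, h2]
    simp only [neg_smul]; abel
  have h4 := congrArg Prod.snd (hinj h3)
  have h5 := eq_zero_of_dot_self h4
  have h6 := congrArg Prod.fst (hinj (h5.trans (map_zero D).symm))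
  simp at h6

/-- The rotation by a right angle in the plane orthogonal to `n`, pulled back by `D`. -/
theorem exists_rotation (hn : n ⬝ᵥ n = 1) (hD : ∀ X, n ⬝ᵥ D X = 0)
    (hinj : Function.Injective D) :
    ∃ R : Plane →ₗ[ℝ] Plane, (∀ X, D (R X) = n ⨯₃ D X) ∧ LinearMap.det R = 1 := by
  have hne := area_ne_zero hn hD hinj
  have hc := cross_eq_smul_normal hn hD (1, 0) (0, 1)
  set a := D (1, 0)
  set b := D (0, 1)
  set w := n ⬝ᵥ (a ⨯₃ b) with hw
  have hw2 : w * w = (a ⬝ᵥ a) * (b ⬝ᵥ b) - (a ⬝ᵥ b) * (a ⬝ᵥ b) := by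
    have := cross_dot_cross a b a b
    rw [hc, smul_dotProduct, dotProduct_smul, hn] at this
    simp only [smul_eq_mul, mul_one] at this
    rw [this, dotProduct_comm b a]
  -- Since `w n = a × b`, the triple product expands `w (n × a)` and `w (n × b)` in `a` and `b`;
  -- these coefficients, divided by `w`, are the columns of `R`.
  have ha : w • (n ⨯₃ a) = (a ⬝ᵥ a) • b - (a ⬝ᵥ b) • a := by
    rw [← LinearMap.smul_apply, ← map_smul, ← hc, cross_cross_eq_smul_sub_smul, dotProduct_comm b a]
  have hb : w • (n ⨯₃ b) = (a ⬝ᵥ b) • b - (b ⬝ᵥ b) • a := by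
    rw [← LinearMap.smul_apply, ← map_smul, ← hc, cross_cross_eq_smul_sub_smul]
  refine ⟨planeMap (w⁻¹ * -(a ⬝ᵥ b), w⁻¹ * (a ⬝ᵥ a)) (w⁻¹ * -(b ⬝ᵥ b), w⁻¹ * (a ⬝ᵥ b)), ?_, ?_⟩
  · intro X
    have h1 : D (w⁻¹ * -(a ⬝ᵥ b), w⁻¹ * (a ⬝ᵥ a)) = n ⨯₃ a := by
      rw [apply_eq_add D, eq_comm, ← inv_smul_smul₀ hne (n ⨯₃ a), ha]
      change w⁻¹ • _ = (w⁻¹ * -(a ⬝ᵥ b)) • a + (w⁻¹ * (a ⬝ᵥ a)) • b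
      module
    have h2 : D (w⁻¹ * -(b ⬝ᵥ b), w⁻¹ * (a ⬝ᵥ b)) = n ⨯₃ b := by
      rw [apply_eq_add D, eq_comm, ← inv_smul_smul₀ hne (n ⨯₃ b), hb]
      change w⁻¹ • _ = (w⁻¹ * -(b ⬝ᵥ b)) • a + (w⁻¹ * (a ⬝ᵥ b)) • b
      module
    rw [planeMap_apply, map_add, map_smul, map_smul, h1, h2, apply_eq_add D X, map_add, map_smul,
      map_smul]
  · rw [det_plane]
    simp only [planeMap_apply, one_smul, zero_smul, add_zero, zero_add]
    -- The determinant is the Gram determinant of `a, b` divided by `w²`, and these agree by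
    -- Lagrange's identity `hw2`.
    have : w⁻¹ * w⁻¹ * (w * w) = 1 := by field_simp
    rw [hw2] at this
    linarith

/-- If `df = n × dn ∘ J` for a trace-free involution `J`, then the shape operator has
determinant `-1`. -/
theorem exists_shape_operator (hn : n ⬝ᵥ n = 1) (hD : ∀ X, n ⬝ᵥ D X = 0)
    (hinj : Function.Injective D) {J : Plane →ₗ[ℝ] Plane} (h : ∀ X, J (J X) = X)
    (ht : (J (1, 0)).1 + (J (0, 1)).2 = 0) :
    ∃ S : Plane →ₗ[ℝ] Plane, (∀ X, n ⨯₃ D (J (S X)) = -D X) ∧ LinearMap.det S = -1 := by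
  obtain ⟨R, hR, hdet⟩ := exists_rotation hn hD hinj
  refine ⟨J ∘ₗ R, fun X => ?_, ?_⟩
  · rw [LinearMap.comp_apply, h, hR, cross_cross_of_orthogonal hn (hD X)]
  · rw [LinearMap.det_comp, hdet, det_eq_neg_one_of_involution J h ht, mul_one]

theorem injective_cross (hn : n ⬝ᵥ n = 1) (hD : ∀ X, n ⬝ᵥ D X = 0)
    (hinj : Function.Injective D) {J : Plane →ₗ[ℝ] Plane} (h : ∀ X, J (J X) = X) :
    Function.Injective (fun X => n ⨯₃ D (J X)) := by
  intro X Y hXY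
  have := congrArg (n ⨯₃ ·) hXY
  simp only [cross_cross_of_orthogonal hn (hD _), neg_inj] at this
  have := congrArg J (hinj this)
  rwa [h, h] at this

theorem alternating_plane (B : Plane →ₗ[ℝ] Plane →ₗ[ℝ] ℝ) (hB : ∀ X Y, B X Y = -B Y X)
    (X Y : Plane) : B X Y = (X.1 * Y.2 - X.2 * Y.1) * B (1, 0) (0, 1) := by
  have h0 : ∀ X, B X X = 0 := fun X => by linarith [hB X X]
  rw [apply_eq_add B X, LinearMap.add_apply, LinearMap.smul_apply, LinearMap.smul_apply,
    apply_eq_add (B (1, 0)) Y, apply_eq_add (B (0, 1)) Y, h0, h0, hB (0, 1) (1, 0)]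
  simp only [smul_eq_mul]; ring

/-- The bilinear form `-(n × dn ∘ J) · dn` is a non-zero multiple of any non-zero bilinear form for
which the involution `J` is skew. -/
theorem exists_conformal_factor (hn : n ⬝ᵥ n = 1) (hD : ∀ X, n ⬝ᵥ D X = 0)
    (hinj : Function.Injective D) {J : Plane →ₗ[ℝ] Plane} (h : ∀ X, J (J X) = X)
    (g : Plane →ₗ[ℝ] Plane →ₗ[ℝ] ℝ) (gs : ∀ X Y, g X Y = g Y X)
    (gJ : ∀ X Y, g (J X) Y = -g X (J Y)) (g0 : ∃ X, g X X ≠ 0) :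
    ∃ t : ℝ, t ≠ 0 ∧ ∀ X Y, -((n ⨯₃ D (J X)) ⬝ᵥ D Y) = t * g X Y := by
  have hne := area_ne_zero hn hD hinj
  -- Skewness of `J` makes `g (J ·, ·)` alternating; so is the pulled-back area form `hO`. Both are
  -- multiples of the determinant, and `J² = 1` recovers `g`.
  have hG := alternating_plane (g ∘ₗ J) (fun X Y => by
    rw [LinearMap.comp_apply, LinearMap.comp_apply, gJ, gs])
  have hg : ∀ X Y, g X Y = ((J X).1 * Y.2 - (J X).2 * Y.1) * (g ∘ₗ J) (1, 0) (0, 1) := by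
    intro X Y
    rw [← hG, LinearMap.comp_apply, h]
  have hO : ∀ X Y, (n ⨯₃ D X) ⬝ᵥ D Y = (X.1 * Y.2 - X.2 * Y.1) * (n ⬝ᵥ (D (1, 0) ⨯₃ D (0, 1))) := by
    intro X Y
    rw [apply_eq_add D X, apply_eq_add D Y]
    generalize D (1, 0) = a
    generalize D (0, 1) = b
    simp only [cross_apply, Matrix.vec3_dotProduct, Pi.add_apply, Pi.smul_apply, smul_eq_mul,
      Matrix.cons_val]
    ring
  set s := (g ∘ₗ J) (1, 0) (0, 1)
  have hs : s ≠ 0 := by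
    rintro hs
    obtain ⟨X, hX⟩ := g0
    rw [hg, hs, mul_zero] at hX
    exact hX rfl
  refine ⟨-(n ⬝ᵥ (D (1, 0) ⨯₃ D (0, 1))) / s, div_ne_zero (neg_ne_zero.mpr hne) hs, fun X Y => ?_⟩
  rw [hO, hg]
  field_simp

end LinearAlgebra

/-! ### Product rules for dot, cross and matrix products; symmetry of second derivatives. -/

section Calculus

variable {E F : Type*} [NormedAddCommGroup E] [NormedSpace ℝ E] [NormedAddCommGroup F]
  [NormedSpace ℝ F]

theorem fderiv_bilin (B : R3 →ₗ[ℝ] R3 →ₗ[ℝ] F) {a b : E → R3} {y : E}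
    (ha : DifferentiableAt ℝ a y) (hb : DifferentiableAt ℝ b y) (v : E) :
    fderiv ℝ (fun z => B (a z) (b z)) y v = B (fderiv ℝ a y v) (b y) + B (a y) (fderiv ℝ b y v) := by
  have := congrArg (· v) (B.toContinuousBilinearMap.fderiv_of_bilinear ha hb)
  simp only [LinearMap.toContinuousBilinearMap_apply] at this
  rw [this, add_comm]; rfl

theorem fderiv_cross {a b : E → R3} {y : E}
    (ha : DifferentiableAt ℝ a y) (hb : DifferentiableAt ℝ b y) (v : E) :
    fderiv ℝ (fun z => a z ⨯₃ b z) y v = fderiv ℝ a y v ⨯₃ b y + a y ⨯₃ fderiv ℝ b y v :=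
  fderiv_bilin crossProduct ha hb v

theorem fderiv_dot {a b : E → R3} {y : E}
    (ha : DifferentiableAt ℝ a y) (hb : DifferentiableAt ℝ b y) (v : E) :
    fderiv ℝ (fun z => a z ⬝ᵥ b z) y v = fderiv ℝ a y v ⬝ᵥ b y + a y ⬝ᵥ fderiv ℝ b y v :=
  fderiv_bilin (dotProductBilin ℝ ℝ) ha hb v

theorem contDiffOn_cross {a b : E → R3} {s : Set E} {n : ℕ∞ω}
    (ha : ContDiffOn ℝ n a s) (hb : ContDiffOn ℝ n b s) :
    ContDiffOn ℝ n (fun z => a z ⨯₃ b z) s :=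
  (crossProduct (R := ℝ)).toContinuousBilinearMap.isBoundedBilinearMap.contDiff.comp_contDiffOn
    (ha.prodMk hb)

theorem fderiv_apply_coord {a : E → R3} {y : E} (ha : DifferentiableAt ℝ a y) (v : E) (i : Fin 3) :
    fderiv ℝ (fun z => a z i) y v = fderiv ℝ a y v i := by
  have := (hasFDerivAt_pi'.mp ha.hasFDerivAt i).fderiv
  rw [this]; rfl

theorem differentiableAt_mulVec {A : E → Matrix (Fin 3) (Fin 3) ℝ} {w : E → R3} {y : E}
    (hA : ∀ i j, DifferentiableAt ℝ (fun z => A z i j) y) (hw : DifferentiableAt ℝ w y) :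
    DifferentiableAt ℝ (fun z => A z *ᵥ w z) y := by
  rw [differentiableAt_pi]
  intro i
  simp only [Matrix.mulVec, dotProduct]
  exact DifferentiableAt.fun_sum fun j _ => (hA i j).mul (differentiableAt_pi.mp hw j)

theorem fderiv_mulVec {A : E → Matrix (Fin 3) (Fin 3) ℝ} {w : E → R3} {y : E}
    (hA : ∀ i j, DifferentiableAt ℝ (fun z => A z i j) y) (hw : DifferentiableAt ℝ w y) (v : E) :
    fderiv ℝ (fun z => A z *ᵥ w z) y v =
      Matrix.of (fun i j => fderiv ℝ (fun z => A z i j) y v) *ᵥ w y + A y *ᵥ fderiv ℝ w y v := by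
  ext i
  rw [← fderiv_apply_coord (differentiableAt_mulVec hA hw)]
  simp only [Matrix.mulVec, dotProduct, Pi.add_apply, Matrix.of_apply]
  rw [fderiv_fun_sum fun j _ => (hA i j).fun_mul (differentiableAt_pi.mp hw j),
    sum_apply, ← Finset.sum_add_distrib]
  refine Finset.sum_congr rfl fun j _ => ?_
  rw [fderiv_fun_mul (hA i j) (differentiableAt_pi.mp hw j), ← fderiv_apply_coord hw]
  simp only [add_apply, smul_apply, smul_eq_mul]
  ring

/-- Product rule for `A w` when the derivative of `A` is known on constant vectors. -/
theorem fderiv_mulVec_const_add {A : E → Matrix (Fin 3) (Fin 3) ℝ} {w : E → R3} {y : E}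
    (hA : ∀ i j, DifferentiableAt ℝ (fun z => A z i j) y) (hw : DifferentiableAt ℝ w y) (v : E) :
    fderiv ℝ (fun z => A z *ᵥ w z) y v =
      fderiv ℝ (fun z => A z *ᵥ w y) y v + A y *ᵥ fderiv ℝ w y v := by
  rw [fderiv_mulVec hA hw, fderiv_mulVec hA (differentiableAt_const _)]
  simp

/-- The second derivatives of a smooth function commute. -/
theorem fderiv_fderiv_comm_of_contDiffAt {f : E → F} {y : E} (hc : ContDiffAt ℝ ∞ f y) (v w : E) :
    fderiv ℝ (fun z => fderiv ℝ f z v) y w = fderiv ℝ (fun z => fderiv ℝ f z w) y v := by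
  have hd : DifferentiableAt ℝ (fderiv ℝ f) y :=
    (hc.fderiv_right (m := ∞) le_rfl).differentiableAt (by simp)
  have h1 : ∀ v w, fderiv ℝ (fun z => fderiv ℝ f z v) y w = fderiv ℝ (fderiv ℝ f) y w v := by
    intro v w
    rw [fderiv_clm_apply hd (differentiableAt_const v)]
    simp
  rw [h1, h1]
  exact (hc.isSymmSndFDerivAt (by
    rw [minSmoothness_of_isRCLikeNormedField]; exact ENat.LEInfty.out)) w v

theorem fderiv_fderiv_comm {f : E → F} {s : Set E} (hs : IsOpen s) (hf : ContDiffOn ℝ ∞ f s)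
    {y : E} (hy : y ∈ s) (v w : E) :
    fderiv ℝ (fun z => fderiv ℝ f z v) y w = fderiv ℝ (fun z => fderiv ℝ f z w) y v :=
  fderiv_fderiv_comm_of_contDiffAt (hf.contDiffAt (hs.mem_nhds hy)) v w

theorem fderiv_congr_of_isOpen {f g : E → F} {s : Set E} (hs : IsOpen s)
    (h : ∀ z ∈ s, f z = g z) {y : E} (hy : y ∈ s) (v : E) : fderiv ℝ f y v = fderiv ℝ g y v := by
  have : f =ᶠ[𝓝 y] g := Filter.eventually_of_mem (hs.mem_nhds hy) h
  rw [this.fderiv_eq]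

theorem contDiffOn_fderiv_apply {f : E → F} {s : Set E} (hs : IsOpen s) (hf : ContDiffOn ℝ ∞ f s)
    {v : E → E} (hv : ContDiffOn ℝ ∞ v s) : ContDiffOn ℝ ∞ (fun z => fderiv ℝ f z (v z)) s :=
  (hf.fderiv_of_isOpen hs le_rfl).clm_apply hv

end Calculus

/-! ### Passing between the surface and its charts; the Hodge star in coordinates. -/

section Charts

variable {M : Type*} [TopologicalSpace M] [ChartedSpace Plane M]
  {F : Type*} [NormedAddCommGroup F] [NormedSpace ℝ F]
  {e : OpenPartialHomeomorph M Plane}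

theorem mdifferentiable_of_mem_maximalAtlas
    (he : e ∈ IsManifold.maximalAtlas 𝓘(ℝ, Plane) ∞ M) :
    e.MDifferentiable 𝓘(ℝ, Plane) 𝓘(ℝ, Plane) :=
  ⟨(contMDiffOn_of_mem_maximalAtlas he).mdifferentiableOn (by simp),
    (contMDiffOn_symm_of_mem_maximalAtlas he).mdifferentiableOn (by simp)⟩

theorem exists_mem_maximalAtlas [IsManifold 𝓘(ℝ, Plane) ∞ M] (x : M) :
    ∃ e ∈ IsManifold.maximalAtlas 𝓘(ℝ, Plane) ∞ M, ∃ y ∈ e.target, e.symm y = x :=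
  ⟨chartAt Plane x, IsManifold.chart_mem_maximalAtlas x, chartAt Plane x x,
    mem_chart_target Plane x, (chartAt Plane x).left_inv (mem_chart_source Plane x)⟩

theorem contDiffOn_comp_symm (he : e ∈ IsManifold.maximalAtlas 𝓘(ℝ, Plane) ∞ M) {f : M → F}
    {s : Set M} (hf : ContMDiffOn 𝓘(ℝ, Plane) 𝓘(ℝ, F) ∞ f s) (hs : e.source ⊆ s) :
    ContDiffOn ℝ ∞ (f ∘ e.symm) e.target :=
  contMDiffOn_iff_contDiffOn.mp
    (hf.comp (contMDiffOn_symm_of_mem_maximalAtlas he) fun _ hy => hs (e.map_target hy))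

theorem fderiv_comp_symm (he : e ∈ IsManifold.maximalAtlas 𝓘(ℝ, Plane) ∞ M) {f : M → F}
    {y : Plane} (hy : y ∈ e.target)
    (hf : MDifferentiableAt 𝓘(ℝ, Plane) 𝓘(ℝ, F) f (e.symm y)) (v : Plane) :
    fderiv ℝ (f ∘ e.symm) y v = mfderiv 𝓘(ℝ, Plane) 𝓘(ℝ, F) f (e.symm y)
      (mfderiv 𝓘(ℝ, Plane) 𝓘(ℝ, Plane) e.symm y v) := by
  rw [← mfderiv_eq_fderiv]
  exact mfderiv_comp_apply y hf ((mdifferentiable_of_mem_maximalAtlas he).mdifferentiableAt_symm hy) v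

theorem mfderiv_symm_mfderiv (he : e ∈ IsManifold.maximalAtlas 𝓘(ℝ, Plane) ∞ M)
    {y : Plane} (hy : y ∈ e.target) (X : TangentSpace 𝓘(ℝ, Plane) (e.symm y)) :
    mfderiv 𝓘(ℝ, Plane) 𝓘(ℝ, Plane) e.symm y
      (mfderiv 𝓘(ℝ, Plane) 𝓘(ℝ, Plane) e (e.symm y) X) = X := by
  have := (mdifferentiable_of_mem_maximalAtlas he).symm_comp_deriv (e.map_target hy)
  rw [e.right_inv hy] at this
  exact DFunLike.congr_fun this X

theorem exists_mfderiv_symm_eq (he : e ∈ IsManifold.maximalAtlas 𝓘(ℝ, Plane) ∞ M)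
    {y : Plane} (hy : y ∈ e.target) (X : TangentSpace 𝓘(ℝ, Plane) (e.symm y)) :
    ∃ v : Plane, mfderiv 𝓘(ℝ, Plane) 𝓘(ℝ, Plane) e.symm y v = X :=
  ⟨_, mfderiv_symm_mfderiv he hy X⟩

theorem mfderiv_mfderiv_symm (he : e ∈ IsManifold.maximalAtlas 𝓘(ℝ, Plane) ∞ M)
    {y : Plane} (hy : y ∈ e.target) (v : Plane) :
    mfderiv 𝓘(ℝ, Plane) 𝓘(ℝ, Plane) e (e.symm y)
      (mfderiv 𝓘(ℝ, Plane) 𝓘(ℝ, Plane) e.symm y v) = v :=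
  DFunLike.congr_fun ((mdifferentiable_of_mem_maximalAtlas he).comp_symm_deriv hy) v

theorem mfderiv_symm_coordEndo (he : e ∈ IsManifold.maximalAtlas 𝓘(ℝ, Plane) ∞ M)
    (J : ∀ x : M, TangentSpace 𝓘(ℝ, Plane) x →L[ℝ] TangentSpace 𝓘(ℝ, Plane) x)
    {y : Plane} (hy : y ∈ e.target) (v : Plane) :
    mfderiv 𝓘(ℝ, Plane) 𝓘(ℝ, Plane) e.symm y (coordEndo J e y v) =
      J (e.symm y) (mfderiv 𝓘(ℝ, Plane) 𝓘(ℝ, Plane) e.symm y v) :=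
  mfderiv_symm_mfderiv he hy _

variable (c : LorentzConformalStructure M)

namespace LorentzConformalStructure

/-- If `J` were the identity, skewness would give `g X X = -g X X` for a vector with `g X X > 0`.
With `exists_J_ne_neg` this makes `J` non-scalar, hence trace-free. -/
theorem exists_J_ne (x : M) : ∃ X, c.J x X ≠ X := by
  by_contra! h
  obtain ⟨X, hX⟩ := c.g_pos x
  have := c.J_skew x X X
  rw [h] at this; linarith

theorem exists_J_ne_neg (x : M) : ∃ X, c.J x X ≠ -X := by
  by_contra! h
  obtain ⟨X, hX⟩ := c.g_pos x
  have := c.J_skew x X X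
  rw [h, map_neg, map_neg, neg_apply] at this; linarith

theorem trace_J (x : M) :
    (show Plane from c.J x ((1, 0) : Plane)).1 + (show Plane from c.J x ((0, 1) : Plane)).2 = 0 :=
  trace_eq_zero_of_involution (c.J x : Plane →L[ℝ] Plane).toLinearMap (c.J_sq x)
    (c.exists_J_ne x) (c.exists_J_ne_neg x)

theorem coordEndo_sq (he : e ∈ IsManifold.maximalAtlas 𝓘(ℝ, Plane) ∞ M) {y : Plane}
    (hy : y ∈ e.target) (v : Plane) : coordEndo c.J e y (coordEndo c.J e y v) = v := by
  conv_lhs => rw [coordEndo]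
  change mfderiv 𝓘(ℝ, Plane) 𝓘(ℝ, Plane) e (e.symm y) (c.J (e.symm y)
    (mfderiv 𝓘(ℝ, Plane) 𝓘(ℝ, Plane) e.symm y (coordEndo c.J e y v))) = v
  rw [mfderiv_symm_coordEndo he c.J hy, c.J_sq, mfderiv_mfderiv_symm he hy]

theorem trace_coordEndo (he : e ∈ IsManifold.maximalAtlas 𝓘(ℝ, Plane) ∞ M) {y : Plane}
    (hy : y ∈ e.target) :
    (coordEndo c.J e y (1, 0)).1 + (coordEndo c.J e y (0, 1)).2 = 0 := by
  refine trace_eq_zero_of_involution (coordEndo c.J e y).toLinearMap (c.coordEndo_sq he hy) ?_ ?_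
  · obtain ⟨X, hX⟩ := c.exists_J_ne (e.symm y)
    refine ⟨mfderiv 𝓘(ℝ, Plane) 𝓘(ℝ, Plane) e (e.symm y) X, fun h => hX ?_⟩
    have := congrArg (mfderiv 𝓘(ℝ, Plane) 𝓘(ℝ, Plane) e.symm y) h
    erw [mfderiv_symm_coordEndo he c.J hy, mfderiv_symm_mfderiv he hy] at this
    exact this
  · obtain ⟨X, hX⟩ := c.exists_J_ne_neg (e.symm y)
    refine ⟨mfderiv 𝓘(ℝ, Plane) 𝓘(ℝ, Plane) e (e.symm y) X, fun h => hX ?_⟩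
    have := congrArg (mfderiv 𝓘(ℝ, Plane) 𝓘(ℝ, Plane) e.symm y) h
    erw [mfderiv_symm_coordEndo he c.J hy, map_neg, mfderiv_symm_mfderiv he hy] at this
    exact this

end LorentzConformalStructure

/-- A map whose differential vanishes on a preconnected open set is constant there. -/
theorem eq_of_d_eq_zero [IsManifold 𝓘(ℝ, Plane) ∞ M] {V : Set M} (hV : IsOpen V)
    (hVc : IsPreconnected V) {f : M → R3} (hf : MDifferentiableOn 𝓘(ℝ, Plane) 𝓘(ℝ, R3) f V)
    (h0 : ∀ x ∈ V, d f x = 0) {x y : M} (hx : x ∈ V) (hy : y ∈ V) : f x = f y := by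
  have : PreconnectedSpace V := isPreconnected_iff_preconnectedSpace.mp hVc
  have hloc : IsLocallyConstant (fun p : V => f p) := by
    rw [IsLocallyConstant.iff_eventually_eq]
    rintro ⟨p, hp⟩
    have he := IsManifold.chart_mem_maximalAtlas (I := 𝓘(ℝ, Plane)) (n := ∞) p
    set e := chartAt Plane p
    have hps : p ∈ e.source := mem_chart_source _ p
    have hopen : IsOpen (e.target ∩ e.symm ⁻¹' V) := e.isOpen_inter_preimage_symm hV
    obtain ⟨r, hr, hball⟩ := Metric.isOpen_iff.mp hopen (e p)
      ⟨e.map_source hps, by simpa [e.left_inv hps] using hp⟩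
    have hmd : ∀ z ∈ Metric.ball (e p) r, MDifferentiableAt 𝓘(ℝ, Plane) 𝓘(ℝ, R3) f (e.symm z) :=
      fun z hz => (hf _ (hball hz).2).mdifferentiableAt (hV.mem_nhds (hball hz).2)
    have hnhds : ∀ᶠ q in 𝓝 p, q ∈ e.source ∩ e ⁻¹' Metric.ball (e p) r :=
      (e.isOpen_inter_preimage Metric.isOpen_ball).mem_nhds ⟨hps, Metric.mem_ball_self hr⟩
    rw [nhds_subtype_eq_comap]
    refine (hnhds.comap _).mono ?_
    rintro ⟨q, hqV⟩ ⟨hq, hqb⟩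
    change f q = f p
    -- Local constancy is read off on a ball in a chart; preconnectedness of `V` then makes it
    -- global.
    have := Metric.isOpen_ball.is_const_of_fderiv_eq_zero (𝕜 := ℝ) (f := f ∘ e.symm)
      (convex_ball (e p) r).isPreconnected (fun z hz => ?_) (fun z hz => ?_) hqb
      (Metric.mem_ball_self hr)
    · simpa [e.left_inv hq, e.left_inv hps] using this
    · exact (mdifferentiableAt_iff_differentiableAt.mp ((hmd z hz).comp z
        ((mdifferentiable_of_mem_maximalAtlas he).mdifferentiableAt_symm
          (hball hz).1))).differentiableWithinAt
    · refine ContinuousLinearMap.ext fun v => ?_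
      rw [fderiv_comp_symm he (hball hz).1 (hmd z hz)]
      have := DFunLike.congr_fun (h0 _ (hball hz).2) (mfderiv 𝓘(ℝ, Plane) 𝓘(ℝ, Plane) e.symm z v)
      exact this
  exact hloc.apply_eq_of_preconnectedSpace ⟨x, hx⟩ ⟨y, hy⟩

end Charts

/-! ### The inclusion of `ℝ³` in `ℂ³`. -/

section Complexification

/-- The inclusion `ℝ³ ⊆ ℂ³` as a continuous linear map. -/
noncomputable def toCL : R3 →L[ℝ] C3 :=
  ContinuousLinearMap.pi fun i => Complex.ofRealCLM.comp (ContinuousLinearMap.proj i)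

theorem toC_injective : Function.Injective toC := fun u v h => by
  ext i; exact Complex.ofReal_injective (congrFun h i)

theorem toC_add (u v : R3) : toC (u + v) = toC u + toC v := map_add toCL u v

theorem toC_sub (u v : R3) : toC (u - v) = toC u - toC v := map_sub toCL u v

theorem toC_neg (u : R3) : toC (-u) = -toC u := map_neg toCL u

theorem toC_smul (r : ℝ) (v : R3) : toC (r • v) = (r : ℂ) • toC v := by
  ext i; simp [toC]

theorem toC_cross (u v : R3) : toC (u ⨯₃ v) = toC u ⨯₃ toC v := by
  ext i
  fin_cases i <;> simp [toC, cross_apply]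

theorem toC_mulVec (A : Matrix (Fin 3) (Fin 3) ℝ) (v : R3) :
    toC (A *ᵥ v) = A.map Complex.ofReal *ᵥ toC v := by
  ext i
  simp [toC, Matrix.mulVec, dotProduct]

end Complexification

/-! ### The gauge condition on real sections. -/

section Gauge

variable {M : Type*} [TopologicalSpace M] [ChartedSpace Plane M]
  {c : LorentzConformalStructure M} {N : M → R3} {s : ℝ} {T : M → Matrix (Fin 3) (Fin 3) ℝ}

/-- The vector of the connection form `-a + s a⁺ + s⁻¹ a⁻`, where `a = a⁺ + a⁻` and
`b = a⁺ - a⁻`. -/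
noncomputable def gaugeVec (s : ℝ) (a b : R3) : R3 := -a + (s / 2) • (a + b) + (s⁻¹ / 2) • (a - b)

theorem dot_gaugeVec {n a b : R3} (ha : n ⬝ᵥ a = 0) (hb : n ⬝ᵥ b = 0) (s : ℝ) :
    n ⬝ᵥ gaugeVec s a b = 0 := by
  simp [gaugeVec, dotProduct_add, dotProduct_sub, ha, hb]

theorem dC_toC {f : M → R3} {x : M} (hf : MDifferentiableAt 𝓘(ℝ, Plane) 𝓘(ℝ, R3) f x)
    (X : TangentSpace 𝓘(ℝ, Plane) x) : dC (fun y => toC (f y)) x X = toC (d f x X) := by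
  have h := (toCL.hasFDerivAt (x := f x)).hasMFDerivAt.comp x hf.hasMFDerivAt
  exact DFunLike.congr_fun h.mfderiv X

theorem dLam_toC {f : M → R3} {x : M} (hf : MDifferentiableAt 𝓘(ℝ, Plane) 𝓘(ℝ, R3) f x)
    (X : TangentSpace 𝓘(ℝ, Plane) x) :
    dLam c N s (fun y => toC (f y)) x X = toC (d f x X +
      gaugeVec s (N x ⨯₃ d N x X) (N x ⨯₃ d N x (c.J x X)) ⨯₃ f x) := by
  simp only [dLam, calD, calNPlus, calNMinus, calN, dC_toC hf, gaugeVec]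
  generalize N x ⨯₃ d N x X = a
  generalize N x ⨯₃ d N x (c.J x X) = b
  simp only [map_add, map_sub, map_neg, map_smul, LinearMap.add_apply, LinearMap.sub_apply,
    LinearMap.neg_apply, LinearMap.smul_apply, toC_add, toC_sub, toC_neg, toC_smul, ← toC_cross]
  push_cast
  module

namespace IsTrivialisingGauge

variable (hT : IsTrivialisingGauge c N (s : ℂ) (fun x => (T x).map Complex.ofReal))
include hT

theorem real_smooth (i j : Fin 3) : ContMDiff 𝓘(ℝ, Plane) 𝓘(ℝ, ℝ) ∞ (fun x => T x i j) := by
  have := (Complex.reCLM.contDiff (n := ∞)).contMDiff.comp (hT.smooth i j)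
  exact this

theorem real_orth (x : M) : T x * (T x)ᵀ = 1 := by
  have h := hT.orth x
  simp only [← Matrix.transpose_map] at h
  apply Matrix.map_injective Complex.ofReal_injective
  change (T x * (T x)ᵀ).map Complex.ofReal = (1 : Matrix (Fin 3) (Fin 3) ℝ).map Complex.ofReal
  rw [Matrix.map_one _ Complex.ofReal_zero Complex.ofReal_one, ← h]
  exact Matrix.map_mul (f := Complex.ofRealHom)

theorem real_det (x : M) : (T x).det = 1 := by
  have h := hT.det x
  apply Complex.ofReal_injective
  rw [Complex.ofReal_one, ← h]
  exact RingHom.map_det Complex.ofRealHom (T x)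

theorem mulVec_smooth {f : M → R3} (hf : ContMDiff 𝓘(ℝ, Plane) 𝓘(ℝ, R3) ∞ f) :
    ContMDiff 𝓘(ℝ, Plane) 𝓘(ℝ, R3) ∞ (fun x => T x *ᵥ f x) := by
  rw [contMDiff_pi_space]
  intro i
  simp only [Matrix.mulVec, dotProduct]
  exact contMDiff_finsetSum fun j _ => (hT.real_smooth i j).mul (contMDiff_pi_space.mp hf j)

/-- The complex gauge identity is tested on the section `toC ∘ f`; both sides are then real, and
`toC` is injective. -/
theorem d_mulVec {f : M → R3} (hf : ContMDiff 𝓘(ℝ, Plane) 𝓘(ℝ, R3) ∞ f) (x : M)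
    (X : TangentSpace 𝓘(ℝ, Plane) x) :
    d (fun y => T y *ᵥ f y) x X = T x *ᵥ (d f x X +
      gaugeVec s (N x ⨯₃ d N x X) (N x ⨯₃ d N x (c.J x X)) ⨯₃ f x) := by
  have h := hT.gauge (fun y => toC (f y))
    ((toCL.contDiff (n := ∞)).contMDiff.comp hf) x X
  rw [dLam_toC ((hf x).mdifferentiableAt (by simp)), ← toC_mulVec] at h
  simp only [← toC_mulVec] at h
  rw [dC_toC ((hT.mulVec_smooth hf x).mdifferentiableAt (by simp))] at h
  exact (toC_injective h).symm

end IsTrivialisingGauge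

end Gauge

/-! ### Harmonic maps and the surfaces that integrate `N × *dN`. -/

section Harmonic

variable {M : Type*} [TopologicalSpace M] [ChartedSpace Plane M]
  {c : LorentzConformalStructure M} {N : M → R3} {e : OpenPartialHomeomorph M Plane}

theorem dot_fderiv_of_unit {E : Type*} [NormedAddCommGroup E] [NormedSpace ℝ E] {a : E → R3}
    {s : Set E} (hs : IsOpen s) (ha : DifferentiableOn ℝ a s) (h1 : ∀ y ∈ s, a y ⬝ᵥ a y = 1)
    {y : E} (hy : y ∈ s) (v : E) : a y ⬝ᵥ fderiv ℝ a y v = 0 := by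
  have hd := ha.differentiableAt (hs.mem_nhds hy)
  have h := fderiv_dot hd hd v
  have hc : (fun z => a z ⬝ᵥ a z) =ᶠ[𝓝 y] fun _ => 1 :=
    Filter.eventually_of_mem (hs.mem_nhds hy) h1
  rw [hc.fderiv_eq, dotProduct_comm (fderiv ℝ a y v)] at h
  simp at h
  linarith

namespace IsHarmonic

variable (hN : IsHarmonic c N)
include hN

theorem contDiffOn (he : e ∈ IsManifold.maximalAtlas 𝓘(ℝ, Plane) ∞ M) :
    ContDiffOn ℝ ∞ (N ∘ e.symm) e.target :=
  contDiffOn_comp_symm he hN.smooth.contMDiffOn (Set.subset_univ _)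

theorem fderiv_eq_d (he : e ∈ IsManifold.maximalAtlas 𝓘(ℝ, Plane) ∞ M) {y : Plane}
    (hy : y ∈ e.target) (v : Plane) : fderiv ℝ (N ∘ e.symm) y v = d N (e.symm y)
      (mfderiv 𝓘(ℝ, Plane) 𝓘(ℝ, Plane) e.symm y v) :=
  fderiv_comp_symm he hy ((hN.smooth _).mdifferentiableAt (by simp)) v

theorem fderiv_coordEndo (he : e ∈ IsManifold.maximalAtlas 𝓘(ℝ, Plane) ∞ M) {y : Plane}
    (hy : y ∈ e.target) (v : Plane) :
    fderiv ℝ (N ∘ e.symm) y (coordEndo c.J e y v) = d N (e.symm y) (c.J (e.symm y)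
      (mfderiv 𝓘(ℝ, Plane) 𝓘(ℝ, Plane) e.symm y v)) := by
  rw [hN.fderiv_eq_d he hy, mfderiv_symm_coordEndo he c.J hy]

theorem dot_fderiv (he : e ∈ IsManifold.maximalAtlas 𝓘(ℝ, Plane) ∞ M) {y : Plane}
    (hy : y ∈ e.target) (v : Plane) : N (e.symm y) ⬝ᵥ fderiv ℝ (N ∘ e.symm) y v = 0 :=
  dot_fderiv_of_unit e.open_target ((hN.contDiffOn he).differentiableOn (by simp))
    (fun _ _ => hN.unit _) hy v

theorem dot_d [IsManifold 𝓘(ℝ, Plane) ∞ M] (x : M) (X : TangentSpace 𝓘(ℝ, Plane) x) :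
    N x ⬝ᵥ d N x X = 0 := by
  obtain ⟨e, he, y, hy, rfl⟩ := exists_mem_maximalAtlas x
  obtain ⟨v, rfl⟩ := exists_mfderiv_symm_eq he hy X
  rw [← hN.fderiv_eq_d he hy]
  exact hN.dot_fderiv he hy _

/-- The 1-form `N × *dN` is closed. -/
theorem closed (he : e ∈ IsManifold.maximalAtlas 𝓘(ℝ, Plane) ∞ M) {y : Plane}
    (hy : y ∈ e.target) :
    fderiv ℝ (fun z => (N ∘ e.symm) z ⨯₃ fderiv ℝ (N ∘ e.symm) z (coordEndo c.J e z (0, 1))) y (1, 0)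
      = fderiv ℝ (fun z => (N ∘ e.symm) z ⨯₃ fderiv ℝ (N ∘ e.symm) z (coordEndo c.J e z (1, 0))) y
        (0, 1) := by
  have hs := hN.contDiffOn he
  have hd : DifferentiableAt ℝ (N ∘ e.symm) y :=
    (hs.differentiableOn (by simp)).differentiableAt (e.open_target.mem_nhds hy)
  have hJ : ∀ v, DifferentiableAt ℝ (fun z => fderiv ℝ (N ∘ e.symm) z (coordEndo c.J e z v)) y :=
    fun v => ((contDiffOn_fderiv_apply e.open_target hs (c.J_smooth e he v)).differentiableOn
      (by simp)).differentiableAt (e.open_target.mem_nhds hy)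
  rw [fderiv_cross hd (hJ _), fderiv_cross hd (hJ _), ← sub_eq_zero]
  have ht := hN.tension e he y hy
  rw [dStarD, map_sub] at ht
  have htr := c.trace_coordEndo he hy
  rw [add_sub_add_comm, Function.comp_apply, ht, add_zero]
  -- The tension term is gone. What remains is `dN ∧ *dN`, which equals `tr J · (N_ξ × N_η)` and
  -- vanishes because `J` is trace-free.
  have key : ∀ v, fderiv ℝ (N ∘ e.symm) y v =
      v.1 • fderiv ℝ (N ∘ e.symm) y (1, 0) + v.2 • fderiv ℝ (N ∘ e.symm) y (0, 1) :=
    fun v => apply_eq_add (fderiv ℝ (N ∘ e.symm) y).toLinearMap v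
  rw [key (coordEndo c.J e y (0, 1)), key (coordEndo c.J e y (1, 0))]
  generalize fderiv ℝ (N ∘ e.symm) y (1, 0) = a
  generalize fderiv ℝ (N ∘ e.symm) y (0, 1) = b
  rw [map_add, map_add, map_smul, map_smul, map_smul, map_smul, cross_self, cross_self,
    ← cross_anticomm a b]
  have : (coordEndo c.J e y (0, 1)).2 = -(coordEndo c.J e y (1, 0)).1 := by linarith
  rw [this]
  module

theorem exists_lelieuvre [IsManifold 𝓘(ℝ, Plane) ∞ M] (x : M) :
    ∃ V : Set M, IsOpen V ∧ x ∈ V ∧ ∃ f : M → R3, IsLelieuvreOn c N V f := by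
  have he := IsManifold.chart_mem_maximalAtlas (I := 𝓘(ℝ, Plane)) (n := ∞) x
  set e := chartAt Plane x
  have hx : x ∈ e.source := mem_chart_source _ x
  obtain ⟨r, hr, hball⟩ := Metric.isOpen_iff.mp e.open_target (e x) (e.map_source hx)
  set A : Plane → Plane →L[ℝ] R3 := fun z =>
    (crossProduct ((N ∘ e.symm) z)).toContinuousLinearMap.comp
      ((fderiv ℝ (N ∘ e.symm) z).comp (coordEndo c.J e z)) with hA
  have hAs : ContDiffOn ℝ ∞ A e.target := by
    rw [contDiffOn_clm_apply]
    exact fun v => contDiffOn_cross (hN.contDiffOn he)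
      (contDiffOn_fderiv_apply e.open_target (hN.contDiffOn he) (c.J_smooth e he v))
  have hAd : DifferentiableOn ℝ A e.target := hAs.differentiableOn (by simp)
  have hsymm : ∀ a ∈ Metric.ball (e x) r, ∀ u v, fderiv ℝ A a u v = fderiv ℝ A a v u := by
    intro a ha u v
    have h1 : ∀ v w, fderiv ℝ (fun z => A z v) a w = fderiv ℝ A a w v := by
      intro v w
      rw [fderiv_clm_apply (hAd.differentiableAt (e.open_target.mem_nhds (hball ha)))
        (differentiableAt_const v)]
      simp
    -- By bilinearity, symmetry of the derivative of `A` reduces to this one equality, which is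
    -- closedness of `N × *dN`.
    have h2 : fderiv ℝ A a (1, 0) (0, 1) = fderiv ℝ A a (0, 1) (1, 0) := by
      rw [← h1, ← h1]; exact hN.closed he (hball ha)
    have h3 : ∀ u v, fderiv ℝ A a u v = u.1 • v.1 • fderiv ℝ A a (1, 0) (1, 0)
        + u.1 • v.2 • fderiv ℝ A a (1, 0) (0, 1) + u.2 • v.1 • fderiv ℝ A a (0, 1) (1, 0)
        + u.2 • v.2 • fderiv ℝ A a (0, 1) (0, 1) := by
      intro u v
      have e1 := apply_eq_add (fderiv ℝ A a).toLinearMap u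
      have e2 := apply_eq_add (fderiv ℝ A a (1, 0)).toLinearMap v
      have e3 := apply_eq_add (fderiv ℝ A a (0, 1)).toLinearMap v
      simp only [ContinuousLinearMap.coe_coe] at e1 e2 e3
      rw [e1, add_apply, smul_apply, smul_apply, e2, e3]
      module
    rw [h3 u v, h3 v u, h2]
    module
  -- Poincaré lemma on a convex coordinate ball.
  obtain ⟨f, hf⟩ := (convex_ball (e x) r).exists_forall_hasFDerivAt_of_fderiv_symmetric
    Metric.isOpen_ball (hAd.mono hball) hsymm
  have hfs : ContDiffOn ℝ ∞ f (Metric.ball (e x) r) := by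
    rw [contDiffOn_infty_iff_fderiv_of_isOpen Metric.isOpen_ball]
    exact ⟨fun z hz => (hf z hz).differentiableAt.differentiableWithinAt,
      (hAs.mono hball).congr fun z hz => (hf z hz).fderiv⟩
  refine ⟨e.source ∩ e ⁻¹' Metric.ball (e x) r, e.isOpen_inter_preimage Metric.isOpen_ball,
    ⟨hx, Metric.mem_ball_self hr⟩, f ∘ e, ?_, ?_⟩
  · exact hfs.contMDiffOn.comp ((contMDiffOn_of_mem_maximalAtlas he).mono Set.inter_subset_left)
      fun _ h => h.2
  · rintro p ⟨hp, hpb⟩ X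
    have hq := hball hpb
    obtain ⟨y, hy, rfl⟩ : ∃ y ∈ e.target, e.symm y = p := ⟨e p, hq, e.left_inv hp⟩
    have h1 : d (f ∘ e) (e.symm y) X = fderiv ℝ f (e (e.symm y))
        (mfderiv 𝓘(ℝ, Plane) 𝓘(ℝ, Plane) e (e.symm y) X) := by
      rw [← mfderiv_eq_fderiv]
      exact mfderiv_comp_apply _ (hf _ hpb).differentiableAt.mdifferentiableAt
        ((mdifferentiable_of_mem_maximalAtlas he).mdifferentiableAt hp) X
    rw [h1, (hf _ hpb).fderiv, e.right_inv hy]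
    change N (e.symm y) ⨯₃ fderiv ℝ (N ∘ e.symm) y (coordEndo c.J e y _) = _
    exact congrArg _ ((hN.fderiv_coordEndo he hy _).trans
      (congrArg (fun Z => d N _ (c.J _ Z)) (mfderiv_symm_mfderiv he hy X)))

/-- A map `f` with `df = N × *dN` is a `K`-surface where `N` is an immersion. -/
theorem isKSurfaceOn [IsManifold 𝓘(ℝ, Plane) ∞ M] {V : Set M} {f : M → R3}
    (hf : IsLelieuvreOn c N V f) (hi : ∀ x ∈ V, Function.Injective (d N x)) :
    IsKSurfaceOn V f N (-1) where
  neg := by norm_num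
  immersed :=
    { smooth := hf.smooth
      smooth_gauss := hN.smooth.contMDiffOn
      immersion := fun x hx => by
        have := injective_cross (D := (d N x : Plane →L[ℝ] R3).toLinearMap) (hN.unit x)
          (hN.dot_d x) (hi x hx) (J := (c.J x : Plane →L[ℝ] Plane).toLinearMap) (c.J_sq x)
        intro X Y hXY
        rw [hf.eq x hx, hf.eq x hx] at hXY
        exact this hXY
      unit := fun x _ => hN.unit x
      normal := fun x hx X => by rw [hf.eq x hx, dot_self_cross] }
  curvature := fun x hx => by
    obtain ⟨S, hS, hdet⟩ := exists_shape_operator (D := (d N x : Plane →L[ℝ] R3).toLinearMap)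
      (hN.unit x) (hN.dot_d x) (hi x hx) (J := (c.J x : Plane →L[ℝ] Plane).toLinearMap)
      (c.J_sq x) (c.trace_J x)
    exact ⟨S, fun X => (hf.eq x hx _).trans (hS X), hdet⟩

theorem secondForm_conformal [IsManifold 𝓘(ℝ, Plane) ∞ M] {V : Set M} {f : M → R3}
    (hf : IsLelieuvreOn c N V f) {x : M} (hx : x ∈ V) (hi : Function.Injective (d N x)) :
    ∃ t : ℝ, t ≠ 0 ∧ ∀ X Y, secondForm f N x X Y = t * c.g x X Y := by
  obtain ⟨X₀, hX₀⟩ := c.g_pos x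
  obtain ⟨t, ht, h⟩ := exists_conformal_factor (D := (d N x : Plane →L[ℝ] R3).toLinearMap)
    (hN.unit x) (hN.dot_d x) hi (J := (c.J x : Plane →L[ℝ] Plane).toLinearMap) (c.J_sq x)
    (LinearMap.mk₂ ℝ (fun X Y : Plane => c.g x X Y)
      (fun X X' Y => DFunLike.congr_fun (map_add (c.g x) X X') Y)
      (fun r X Y => DFunLike.congr_fun (map_smul (c.g x) r X) Y)
      (fun X Y Y' => map_add (c.g x X) Y Y') (fun r X Y => map_smul (c.g x X) r Y))
    (c.g_symm x) (c.J_skew x) ⟨X₀, hX₀.ne'⟩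
  refine ⟨t, ht, fun X Y => ?_⟩
  rw [secondForm, hf.eq x hx]
  exact h X Y

end IsHarmonic

end Harmonic

/-! ### Transforming a harmonic map by a trivialising gauge. -/

section Transform

variable {M : Type*} [TopologicalSpace M] [ChartedSpace Plane M]
  {c : LorentzConformalStructure M} {N : M → R3} {s : ℝ} {T : M → Matrix (Fin 3) (Fin 3) ℝ}
  {e : OpenPartialHomeomorph M Plane}

/-- As `(n × a) × n = a` on the plane `n^⊥`, the summand `-a` of the connection cancels `dN`,
leaving only the terms with weights `s` and `s⁻¹`. -/
theorem add_gaugeVec_cross {n a b : R3} (hn : n ⬝ᵥ n = 1) (ha : n ⬝ᵥ a = 0) (hb : n ⬝ᵥ b = 0)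
    (s : ℝ) : a + gaugeVec s (n ⨯₃ a) (n ⨯₃ b) ⨯₃ n =
      ((s + s⁻¹) / 2) • a + ((s - s⁻¹) / 2) • b := by
  simp only [gaugeVec, map_add, map_sub, map_neg, map_smul, LinearMap.add_apply,
    LinearMap.sub_apply, LinearMap.neg_apply, LinearMap.smul_apply,
    cross_cross_of_orthogonal_left hn ha, cross_cross_of_orthogonal_left hn hb]
  module

namespace IsTrivialisingGauge

variable (hT : IsTrivialisingGauge c N (s : ℂ) (fun x => (T x).map Complex.ofReal))
include hT

theorem mulVec_injective (x : M) : Function.Injective (T x *ᵥ ·) := by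
  intro u v h
  have := congrArg ((T x)ᵀ *ᵥ ·) h
  simpa [Matrix.mulVec_mulVec, mul_eq_one_comm.mp (hT.real_orth x)] using this

theorem contDiffOn_comp_symm (he : e ∈ IsManifold.maximalAtlas 𝓘(ℝ, Plane) ∞ M) (i j : Fin 3) :
    ContDiffOn ℝ ∞ (fun z => T (e.symm z) i j) e.target :=
  KSurf.contDiffOn_comp_symm he (hT.real_smooth i j).contMDiffOn (Set.subset_univ _)

theorem differentiableAt_comp_symm (he : e ∈ IsManifold.maximalAtlas 𝓘(ℝ, Plane) ∞ M)
    {y : Plane} (hy : y ∈ e.target) (i j : Fin 3) :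
    DifferentiableAt ℝ (fun z => T (e.symm z) i j) y :=
  ((hT.contDiffOn_comp_symm he i j).differentiableOn (by simp)).differentiableAt
    (e.open_target.mem_nhds hy)

variable (hN : IsHarmonic c N)
include hN

/-- On constant sections the gauge identity becomes the equation `dT = T (A ×)`, written in a chart.
-/
theorem fderiv_mulVec_const (he : e ∈ IsManifold.maximalAtlas 𝓘(ℝ, Plane) ∞ M)
    {y : Plane} (hy : y ∈ e.target) (u : R3) (v : Plane) :
    fderiv ℝ (fun z => T (e.symm z) *ᵥ u) y v = T (e.symm y) *ᵥ
      (gaugeVec s (N (e.symm y) ⨯₃ fderiv ℝ (N ∘ e.symm) y v)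
        (N (e.symm y) ⨯₃ fderiv ℝ (N ∘ e.symm) y (coordEndo c.J e y v)) ⨯₃ u) := by
  have hu : ContMDiff 𝓘(ℝ, Plane) 𝓘(ℝ, R3) ∞ (fun _ : M => u) := contMDiff_const
  have h := hT.d_mulVec hu (e.symm y) (mfderiv 𝓘(ℝ, Plane) 𝓘(ℝ, Plane) e.symm y v)
  rw [hN.fderiv_eq_d he hy, hN.fderiv_coordEndo he hy]
  have h0 : d (fun _ : M => u) (e.symm y) = 0 := mfderiv_const
  rw [h0, zero_apply, zero_add] at h
  rw [← h]
  exact fderiv_comp_symm he hy ((hT.mulVec_smooth hu _).mdifferentiableAt (by simp)) v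

variable [IsManifold 𝓘(ℝ, Plane) ∞ M]

theorem d_transform (x : M) (X : TangentSpace 𝓘(ℝ, Plane) x) :
    d (fun y => T y *ᵥ N y) x X = T x *ᵥ d N x
      (((s + s⁻¹) / 2) • X + ((s - s⁻¹) / 2) • c.J x X) := by
  rw [hT.d_mulVec hN.smooth, add_gaugeVec_cross (hN.unit x) (hN.dot_d x _) (hN.dot_d x _),
    map_add, map_smul, map_smul]

theorem injective_d_transform (hs : s ≠ 0) {x : M} (hi : Function.Injective (d N x)) :
    Function.Injective (d (fun y => T y *ᵥ N y) x) := by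
  intro X Y h
  rw [hT.d_transform hN, hT.d_transform hN] at h
  have h1 := hi (hT.mulVec_injective x h)
  have h2 := congrArg (fun Z => ((s + s⁻¹) / 2) • Z - ((s - s⁻¹) / 2) • c.J x Z) h1
  -- With `C = (s + s⁻¹)/2` and `S = (s - s⁻¹)/2`, the inverse of `C + S J` is `C - S J`, because
  -- `J² = 1` and `C² - S² = 1`.
  have h3 : ∀ Z : TangentSpace 𝓘(ℝ, Plane) x,
      ((s + s⁻¹) / 2) • (((s + s⁻¹) / 2) • Z + ((s - s⁻¹) / 2) • c.J x Z) -
        ((s - s⁻¹) / 2) • c.J x (((s + s⁻¹) / 2) • Z + ((s - s⁻¹) / 2) • c.J x Z) = Z := by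
    intro Z
    rw [map_add, map_smul, map_smul, c.J_sq]
    have : ((s + s⁻¹) / 2) * ((s + s⁻¹) / 2) - ((s - s⁻¹) / 2) * ((s - s⁻¹) / 2) = 1 := by
      field_simp; ring
    conv_rhs => rw [← one_smul ℝ Z, ← this]
    module
  simpa only [h3] using h2

theorem fderiv_transform (he : e ∈ IsManifold.maximalAtlas 𝓘(ℝ, Plane) ∞ M)
    {y : Plane} (hy : y ∈ e.target) (v : Plane) :
    fderiv ℝ ((fun x => T x *ᵥ N x) ∘ e.symm) y v = T (e.symm y) *ᵥ
      (((s + s⁻¹) / 2) • fderiv ℝ (N ∘ e.symm) y v +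
        ((s - s⁻¹) / 2) • fderiv ℝ (N ∘ e.symm) y (coordEndo c.J e y v)) := by
  rw [hN.fderiv_eq_d he hy, hN.fderiv_coordEndo he hy, ← map_smul, ← map_smul, ← map_add,
    ← hT.d_transform hN]
  exact fderiv_comp_symm he hy ((hT.mulVec_smooth hN.smooth _).mdifferentiableAt (by simp)) v

theorem fderiv_transform_coordEndo (he : e ∈ IsManifold.maximalAtlas 𝓘(ℝ, Plane) ∞ M)
    {y : Plane} (hy : y ∈ e.target) (v u : Plane) :
    fderiv ℝ (fun z => fderiv ℝ ((fun x => T x *ᵥ N x) ∘ e.symm) z (coordEndo c.J e z v)) y u =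
      T (e.symm y) *ᵥ (gaugeVec s (N (e.symm y) ⨯₃ fderiv ℝ (N ∘ e.symm) y u)
        (N (e.symm y) ⨯₃ fderiv ℝ (N ∘ e.symm) y (coordEndo c.J e y u)) ⨯₃
          (((s + s⁻¹) / 2) • fderiv ℝ (N ∘ e.symm) y (coordEndo c.J e y v) +
            ((s - s⁻¹) / 2) • fderiv ℝ (N ∘ e.symm) y v) +
        (((s + s⁻¹) / 2) • fderiv ℝ (fun z => fderiv ℝ (N ∘ e.symm) z (coordEndo c.J e z v)) y u +
          ((s - s⁻¹) / 2) • fderiv ℝ (fun z => fderiv ℝ (N ∘ e.symm) z v) y u)) := by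
  have hnh := e.open_target.mem_nhds hy
  -- Replacing `v` by `Jv` interchanges the two derivatives of `N`, again by `J² = 1`.
  have heq : (fun z => fderiv ℝ ((fun x => T x *ᵥ N x) ∘ e.symm) z (coordEndo c.J e z v))
      =ᶠ[𝓝 y] fun z => T (e.symm z) *ᵥ
        (((s + s⁻¹) / 2) • fderiv ℝ (N ∘ e.symm) z (coordEndo c.J e z v) +
          ((s - s⁻¹) / 2) • fderiv ℝ (N ∘ e.symm) z v) := by
    filter_upwards [hnh] with z hz
    rw [hT.fderiv_transform hN he hz, c.coordEndo_sq he hz]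
  have hc := hN.contDiffOn he
  have h1 : DifferentiableAt ℝ (fun z => fderiv ℝ (N ∘ e.symm) z (coordEndo c.J e z v)) y :=
    ((contDiffOn_fderiv_apply e.open_target hc (c.J_smooth e he v)).differentiableOn
      (by simp)).differentiableAt hnh
  have h2 : DifferentiableAt ℝ (fun z => fderiv ℝ (N ∘ e.symm) z v) y :=
    ((contDiffOn_fderiv_apply e.open_target hc contDiffOn_const).differentiableOn
      (by simp)).differentiableAt hnh
  rw [heq.fderiv_eq, fderiv_mulVec_const_add (hT.differentiableAt_comp_symm he hy)
    ((h1.fun_const_smul _).fun_add (h2.fun_const_smul _)), hT.fderiv_mulVec_const hN he hy, ← Matrix.mulVec_add,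
    fderiv_fun_add (h1.fun_const_smul _) (h2.fun_const_smul _), fderiv_fun_const_smul h1,
    fderiv_fun_const_smul h2]
  rfl

/-- The transform `T N` of a harmonic map by a trivialising gauge is harmonic. -/
theorem isHarmonic_transform : IsHarmonic c (fun x => T x *ᵥ N x) where
  smooth := hT.mulVec_smooth hN.smooth
  unit := fun x => by rw [mulVec_dot_mulVec (hT.real_orth x), hN.unit]
  tension := fun e he y hy => by
    rw [dStarD, hT.fderiv_transform_coordEndo hN he hy, hT.fderiv_transform_coordEndo hN he hy,
      ← Matrix.mulVec_sub, mulVec_cross (hT.real_orth _) (hT.real_det _)]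
    -- The connection vector and the tangent vector are both orthogonal to `N`, so their cross
    -- product is normal to the sphere and does not contribute to the tension.
    have hperp : ∀ u v : Plane, N (e.symm y) ⨯₃ (gaugeVec s
        (N (e.symm y) ⨯₃ fderiv ℝ (N ∘ e.symm) y u)
        (N (e.symm y) ⨯₃ fderiv ℝ (N ∘ e.symm) y (coordEndo c.J e y u)) ⨯₃
          (((s + s⁻¹) / 2) • fderiv ℝ (N ∘ e.symm) y (coordEndo c.J e y v) +
            ((s - s⁻¹) / 2) • fderiv ℝ (N ∘ e.symm) y v)) = 0 := fun u v =>
      cross_cross_eq_zero (dot_gaugeVec (dot_self_cross _ _) (dot_self_cross _ _) s)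
        (by simp [dotProduct_add, hN.dot_fderiv he hy])
    have ht := hN.tension e he y hy
    rw [dStarD, map_sub] at ht
    -- The terms with weight `(s - s⁻¹)/2` are mixed partials of `N` and cancel; the rest is a
    -- multiple of the tension of `N`.
    rw [fderiv_fderiv_comm e.open_target (hN.contDiffOn he) hy (0, 1) (1, 0)]
    rw [map_sub, map_add (crossProduct (N _)), hperp, zero_add, map_add (crossProduct (N _)),
      map_add (crossProduct (N _)), hperp, zero_add, map_add (crossProduct (N _)),
      map_smul, map_smul, map_smul, add_sub_add_right_eq_sub, ← smul_sub, ht, smul_zero, Matrix.mulVec_zero]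

end IsTrivialisingGauge

end Transform

/-! ### The sine-Gordon equation from the frame of a harmonic map. -/

section SineGordon

/-- The hypotheses force `p = k (n × a) - n` and `q = l (n × b) - n`, so `p · q - 1 = k l (a · b)`,
while `(b · p)(a · q) = -k l (1 - (a · b)²)`. It is used with `a = n_ξ`, `b = n_η`, `p = n_ξξ`, `q =
n_ηη`. -/
theorem dot_sub_one_of_frame {n a b p q : R3} (hn : n ⬝ᵥ n = 1) (ha : a ⬝ᵥ a = 1)
    (hb : b ⬝ᵥ b = 1) (hna : n ⬝ᵥ a = 0) (hnb : n ⬝ᵥ b = 0) (hpn : n ⬝ᵥ p = -1)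
    (hqn : n ⬝ᵥ q = -1) (hpa : a ⬝ᵥ p = 0) (hqb : b ⬝ᵥ q = 0) :
    (1 - (a ⬝ᵥ b) ^ 2) * (p ⬝ᵥ q - 1) = -((b ⬝ᵥ p) * (a ⬝ᵥ q) * (a ⬝ᵥ b)) := by
  have frame : ∀ {a p : R3}, a ⬝ᵥ a = 1 → n ⬝ᵥ a = 0 → n ⬝ᵥ p = -1 → a ⬝ᵥ p = 0 →
      ∃ k : ℝ, p = k • (n ⨯₃ a) - n := by
    intro a p ha hna hpn hpa
    refine ⟨(n ⨯₃ a) ⬝ᵥ (p + n), ?_⟩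
    rw [← eq_smul_of_cross_eq_zero, add_sub_cancel_right]
    · rw [cross_dot_cross_of_orthogonal hn hna, ha]
    · rw [cross_cross_eq_smul_sub_smul, dotProduct_add, dotProduct_add, hpn, hn, hpa,
        dotProduct_comm a n, hna]
      simp
  obtain ⟨k, rfl⟩ := frame ha hna hpn hpa
  obtain ⟨l, rfl⟩ := frame hb hnb hqn hqb
  have e1 : n ⬝ᵥ (n ⨯₃ a) = 0 := dot_self_cross _ _
  have e2 : n ⬝ᵥ (n ⨯₃ b) = 0 := dot_self_cross _ _
  have e3 : (n ⨯₃ a) ⬝ᵥ (n ⨯₃ b) = a ⬝ᵥ b := cross_dot_cross_of_orthogonal hn hnb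
  have e4 : b ⬝ᵥ (n ⨯₃ a) = -(a ⬝ᵥ (n ⨯₃ b)) := by
    simp only [cross_apply, Matrix.vec3_dotProduct, Matrix.cons_val]
    ring
  have e5 : (a ⬝ᵥ (n ⨯₃ b)) ^ 2 = 1 - (a ⬝ᵥ b) ^ 2 := by
    have h := cross_dot_cross a b a b
    rw [eq_smul_of_cross_eq_zero hn (cross_cross_eq_zero hna hnb), smul_dotProduct,
      dotProduct_smul, hn, ha, hb, dotProduct_comm b a] at h
    have h' : n ⬝ᵥ (a ⨯₃ b) = -(a ⬝ᵥ (n ⨯₃ b)) := by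
      rw [triple_product_permutation, ← cross_anticomm, dotProduct_neg]
    rw [h'] at h
    simp only [smul_eq_mul] at h
    linarith
  simp only [dotProduct_sub, sub_dotProduct, smul_dotProduct, dotProduct_smul, smul_eq_mul, e1, e2,
    e3, e4, hn, dotProduct_comm b n, hnb, dotProduct_comm a n, hna, dotProduct_comm _ n]
  linear_combination (-(k * l * (a ⬝ᵥ b))) * e5

/-- The angle of a harmonic map with unit null derivatives solves the sine-Gordon equation. -/
theorem sineGordon_of_harmonic {U : Set Plane} (hU : IsOpen U) {n : Plane → R3} {om : Plane → ℝ}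
    (hn : ContDiffOn ℝ ∞ n U) (hom : ContDiffOn ℝ ∞ om U) (h1 : ∀ y ∈ U, n y ⬝ᵥ n y = 1)
    (hx : ∀ y ∈ U, fderiv ℝ n y (1, 0) ⬝ᵥ fderiv ℝ n y (1, 0) = 1)
    (hy : ∀ y ∈ U, fderiv ℝ n y (0, 1) ⬝ᵥ fderiv ℝ n y (0, 1) = 1)
    (hxy : ∀ y ∈ U, fderiv ℝ n y (1, 0) ⬝ᵥ fderiv ℝ n y (0, 1) = -Real.cos (om y))
    (hh : ∀ y ∈ U, n y ⨯₃ fderiv ℝ (fun z => fderiv ℝ n z (1, 0)) y (0, 1) = 0)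
    (hs : ∀ y ∈ U, Real.sin (om y) ≠ 0) {y : Plane} (hyU : y ∈ U) :
    fderiv ℝ (fun z => fderiv ℝ om z (1, 0)) y (0, 1) = Real.sin (om y) := by
  have pd : ∀ {F : Type} [NormedAddCommGroup F] [NormedSpace ℝ F] {g : Plane → F} (v : Plane),
      ContDiffOn ℝ ∞ g U → ContDiffOn ℝ ∞ (fun z => fderiv ℝ g z v) U :=
    fun v hg => contDiffOn_fderiv_apply hU hg contDiffOn_const
  have da : ∀ {F : Type} [NormedAddCommGroup F] [NormedSpace ℝ F] {g : Plane → F} {z : Plane},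
      ContDiffOn ℝ ∞ g U → z ∈ U → DifferentiableAt ℝ g z :=
    fun hg hz => (hg.differentiableOn (by simp)).differentiableAt (hU.mem_nhds hz)
  have ev : ∀ {F : Type} [NormedAddCommGroup F] [NormedSpace ℝ F] {g h : Plane → F} {z : Plane}
      (v : Plane), z ∈ U → (∀ w ∈ U, g w = h w) → fderiv ℝ g z v = fderiv ℝ h z v :=
    fun v hz hgh => fderiv_congr_of_isOpen hU hgh hz v
  set nx := fun z => fderiv ℝ n z (1, 0) with hnx
  set ny := fun z => fderiv ℝ n z (0, 1) with hny
  have snx : ContDiffOn ℝ ∞ nx U := pd _ hn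
  have sny : ContDiffOn ℝ ∞ ny U := pd _ hn
  have onx : ∀ z ∈ U, n z ⬝ᵥ nx z = 0 := fun z hz =>
    dot_fderiv_of_unit hU (hn.differentiableOn (by simp)) h1 hz _
  have ony : ∀ z ∈ U, n z ⬝ᵥ ny z = 0 := fun z hz =>
    dot_fderiv_of_unit hU (hn.differentiableOn (by simp)) h1 hz _
  have comm : ∀ z ∈ U, fderiv ℝ ny z (1, 0) = fderiv ℝ nx z (0, 1) := fun z hz =>
    fderiv_fderiv_comm hU hn hz _ _
  -- Harmonicity makes `n_ξη` normal; its coefficient comes from differentiating `n · n_ξ = 0`.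
  have nxy : ∀ z ∈ U, fderiv ℝ nx z (0, 1) = Real.cos (om z) • n z := by
    intro z hz
    have h := fderiv_dot (da hn hz) (da snx hz) (0, 1)
    rw [ev (h := fun _ => 0) _ hz onx] at h
    simp only [fderiv_const_apply, zero_apply] at h
    have e : ny z ⬝ᵥ nx z = -Real.cos (om z) := by rw [dotProduct_comm]; exact hxy z hz
    have h2 : n z ⬝ᵥ fderiv ℝ nx z (0, 1) = Real.cos (om z) := by
      change 0 = ny z ⬝ᵥ nx z + _ at h
      linarith
    rw [eq_smul_of_cross_eq_zero (h1 z hz) (hh z hz), h2]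
  have hcos : ∀ z ∈ U, ∀ v, fderiv ℝ (fun w => Real.cos (om w)) z v =
      -(Real.sin (om z) * fderiv ℝ om z v) := by
    intro z hz v
    rw [fderiv_cos (da hom hz)]
    simp
  have hsin : ∀ z ∈ U, ∀ v, fderiv ℝ (fun w => Real.sin (om w)) z v =
      Real.cos (om z) * fderiv ℝ om z v := by
    intro z hz v
    rw [fderiv_sin (da hom hz)]
    simp
  have hang : ∀ z ∈ U, ∀ v, fderiv ℝ (fun w => nx w ⬝ᵥ ny w) z v =
      Real.sin (om z) * fderiv ℝ om z v := by
    intro z hz v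
    rw [ev (h := fun w => -Real.cos (om w)) v hz hxy, fderiv_fun_neg, neg_apply, hcos z hz, neg_neg]
  have nxx_ny : ∀ z ∈ U, fderiv ℝ nx z (1, 0) ⬝ᵥ ny z = Real.sin (om z) * fderiv ℝ om z (1, 0) := by
    intro z hz
    rw [← hang z hz, fderiv_dot (da snx hz) (da sny hz), comm z hz, nxy z hz, dotProduct_smul,
      dotProduct_comm (nx z), onx z hz]
    simp
  have nyy_nx : ∀ z ∈ U, nx z ⬝ᵥ fderiv ℝ ny z (0, 1) = Real.sin (om z) * fderiv ℝ om z (0, 1) := by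
    intro z hz
    rw [← hang z hz, fderiv_dot (da snx hz) (da sny hz), nxy z hz, smul_dotProduct, ony z hz]
    simp
  have nxx_nx : nx y ⬝ᵥ fderiv ℝ nx y (1, 0) = 0 :=
    dot_fderiv_of_unit hU (snx.differentiableOn (by simp)) hx hyU _
  have nyy_ny : ny y ⬝ᵥ fderiv ℝ ny y (0, 1) = 0 :=
    dot_fderiv_of_unit hU (sny.differentiableOn (by simp)) hy hyU _
  have nxx_n : n y ⬝ᵥ fderiv ℝ nx y (1, 0) = -1 := by
    have h := fderiv_dot (da hn hyU) (da snx hyU) (1, 0)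
    rw [ev (h := fun _ => 0) _ hyU onx] at h
    simp only [fderiv_const_apply, zero_apply] at h
    have := hx y hyU
    linarith
  have nyy_n : n y ⬝ᵥ fderiv ℝ ny y (0, 1) = -1 := by
    have h := fderiv_dot (da hn hyU) (da sny hyU) (0, 1)
    rw [ev (h := fun _ => 0) _ hyU ony] at h
    simp only [fderiv_const_apply, zero_apply] at h
    have := hy y hyU
    linarith
  -- The third derivative is `(cos ω n)_ξ`, whose only component along `n_η` is `cos ω (n_ξ · n_η)`.
  have third : fderiv ℝ (fun z => fderiv ℝ nx z (1, 0)) y (0, 1) ⬝ᵥ ny y =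
      -Real.cos (om y) ^ 2 := by
    have hc : DifferentiableAt ℝ (fun w => Real.cos (om w)) y := (da hom hyU).cos
    rw [fderiv_fderiv_comm hU snx hyU, ev (h := fun w => Real.cos (om w) • n w) _ hyU nxy,
      fderiv_fun_smul hc (da hn hyU)]
    simp only [add_apply, smul_apply, ContinuousLinearMap.smulRight_apply, add_dotProduct,
      smul_dotProduct, ony y hyU]
    have := hxy y hyU
    simp only [smul_eq_mul, mul_zero, add_zero]
    rw [this]; ring
  have hfr := dot_sub_one_of_frame (h1 y hyU) (hx y hyU) (hy y hyU) (onx y hyU) (ony y hyU)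
    nxx_n nyy_n nxx_nx nyy_ny
  -- Differentiating `n_ξξ · n_η = sin ω ω_ξ` in `η` brings in `ω_ξη`. By `hP` the term `n_ξξ ·
  -- n_ηη` is `1 + cos ω ω_ξ ω_η`, so the first-order terms cancel and `sin ω ω_ξη = 1 - cos² ω`
  -- remains.
  have hfinal := fderiv_dot (da (pd (1, 0) snx) hyU) (da sny hyU) (0, 1)
  rw [ev (h := fun z => Real.sin (om z) * fderiv ℝ om z (1, 0)) _ hyU nxx_ny,
    fderiv_fun_mul (da hom hyU).sin (da (pd (1, 0) hom) hyU), third] at hfinal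
  simp only [add_apply, smul_apply, smul_eq_mul, hsin y hyU] at hfinal
  have e1 : ny y ⬝ᵥ fderiv ℝ nx y (1, 0) = Real.sin (om y) * fderiv ℝ om y (1, 0) := by
    rw [dotProduct_comm]; exact nxx_ny y hyU
  have e2 := nyy_nx y hyU
  have e3 : nx y ⬝ᵥ ny y = -Real.cos (om y) := hxy y hyU
  change (1 - (nx y ⬝ᵥ ny y) ^ 2) * (_ - 1) = -((ny y ⬝ᵥ _) * (nx y ⬝ᵥ _) * (nx y ⬝ᵥ ny y)) at hfr
  rw [e1, e2, e3] at hfr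
  have hsq := Real.sin_sq_add_cos_sq (om y)
  have hs0 := hs y hyU
  set S := Real.sin (om y)
  set C := Real.cos (om y)
  set P := fderiv ℝ nx y (1, 0) ⬝ᵥ fderiv ℝ ny y (0, 1)
  have hP : P - 1 = C * fderiv ℝ om y (1, 0) * fderiv ℝ om y (0, 1) := by
    apply mul_left_cancel₀ (pow_ne_zero 2 hs0)
    linear_combination hfr + (P - 1) * hsq
  apply mul_left_cancel₀ hs0
  linear_combination hfinal + hP - hsq

end SineGordon

/-! ### Null and Tchebyshev coordinates; the Lie transform. -/

section LieTransform

theorem d_eq_fderiv (f : Plane → R3) (y v : Plane) : d f y v = fderiv ℝ f y v := by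
  rw [d, mfderiv_eq_fderiv]; rfl

theorem hasFirstFormOn_iff {U : Set Plane} {f : Plane → R3} {A B : ℝ} {om : Plane → ℝ} :
    HasFirstFormOn U f A om B ↔ ∀ y ∈ U,
      fderiv ℝ f y (1, 0) ⬝ᵥ fderiv ℝ f y (1, 0) = A ∧
      fderiv ℝ f y (1, 0) ⬝ᵥ fderiv ℝ f y (0, 1) = Real.cos (om y) ∧
      fderiv ℝ f y (0, 1) ⬝ᵥ fderiv ℝ f y (0, 1) = B := by
  have expand : ∀ y : Plane, ∀ a b : ℝ, firstForm f y (a, b) (a, b) =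
      (fderiv ℝ f y (1, 0) ⬝ᵥ fderiv ℝ f y (1, 0)) * a ^ 2 +
        2 * (fderiv ℝ f y (1, 0) ⬝ᵥ fderiv ℝ f y (0, 1)) * a * b +
        (fderiv ℝ f y (0, 1) ⬝ᵥ fderiv ℝ f y (0, 1)) * b ^ 2 := by
    intro y a b
    have h : fderiv ℝ f y (a, b) = a • fderiv ℝ f y (1, 0) + b • fderiv ℝ f y (0, 1) :=
      apply_eq_add (fderiv ℝ f y).toLinearMap (a, b)
    change d f y _ ⬝ᵥ d f y _ = _
    rw [d_eq_fderiv f y (a, b), h]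
    simp only [dotProduct_add, add_dotProduct, smul_dotProduct, dotProduct_smul, smul_eq_mul,
      dotProduct_comm (fderiv ℝ f y (0, 1)) (fderiv ℝ f y (1, 0))]
    ring
  constructor
  · intro h y hy
    have h1 := h y hy 1 0
    have h2 := h y hy 0 1
    have h3 := h y hy 1 1
    rw [expand] at h1 h2 h3
    refine ⟨?_, ?_, ?_⟩ <;> linarith
  · intro h y hy a b
    obtain ⟨h1, h2, h3⟩ := h y hy
    rw [expand, h1, h2, h3]

/-- `lieScale` as a continuous linear map. -/
noncomputable def lieScaleL (μ : ℝ) : Plane →L[ℝ] Plane :=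
  (μ⁻¹ • ContinuousLinearMap.fst ℝ ℝ ℝ).prod (μ • ContinuousLinearMap.snd ℝ ℝ ℝ)

theorem lieScaleL_fst (μ : ℝ) : lieScaleL μ (1, 0) = μ⁻¹ • (1, 0) := by
  ext <;> simp [lieScaleL]

theorem lieScaleL_snd (μ : ℝ) : lieScaleL μ (0, 1) = μ • (0, 1) := by
  ext <;> simp [lieScaleL]

theorem lieScaleL_injective {μ : ℝ} (hμ : μ ≠ 0) : Function.Injective (lieScaleL μ) := by
  rintro ⟨a, b⟩ ⟨a', b'⟩ h
  simpa [lieScaleL, hμ] using h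

theorem fderiv_comp_lieScale {F : Type*} [NormedAddCommGroup F] [NormedSpace ℝ F] {μ : ℝ}
    {g : Plane → F} {y : Plane} (hg : DifferentiableAt ℝ g (lieScale μ y)) (v : Plane) :
    fderiv ℝ (g ∘ lieScale μ) y v = fderiv ℝ g (lieScale μ y) (lieScaleL μ v) := by
  have h := hg.hasFDerivAt.comp y (lieScaleL μ).hasFDerivAt
  exact DFunLike.congr_fun h.fderiv v

theorem contDiffOn_comp_lieScale {F : Type*} [NormedAddCommGroup F] [NormedSpace ℝ F] {μ : ℝ}
    {g : Plane → F} {U : Set Plane} (hg : ContDiffOn ℝ ∞ g U) :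
    ContDiffOn ℝ ∞ (g ∘ lieScale μ) (lieScale μ ⁻¹' U) :=
  hg.comp (lieScaleL μ).contDiff.contDiffOn fun _ h => h

theorem isOpen_preimage_lieScale {μ : ℝ} {U : Set Plane} (hU : IsOpen U) :
    IsOpen (lieScale μ ⁻¹' U) := hU.preimage (lieScaleL μ).continuous

/-- The mixed derivative picks up the factor `μ⁻¹ μ = 1`. -/
theorem SineGordonOn.comp_lieScale {μ : ℝ} (hμ : μ ≠ 0) {U : Set Plane} (hU : IsOpen U) {K : ℝ}
    {om : Plane → ℝ} (h : SineGordonOn U K om) :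
    SineGordonOn (lieScale μ ⁻¹' U) K (om ∘ lieScale μ) := by
  refine ⟨contDiffOn_comp_lieScale h.1, fun y hy => ?_⟩
  have hpd : ContDiffOn ℝ ∞ (fun z => fderiv ℝ om z (1, 0)) U :=
    contDiffOn_fderiv_apply hU h.1 contDiffOn_const
  have hd : DifferentiableAt ℝ (fun z => fderiv ℝ om z (1, 0)) (lieScale μ y) :=
    (hpd.differentiableOn (by simp)).differentiableAt (hU.mem_nhds hy)
  have e1 : ∀ z ∈ lieScale μ ⁻¹' U, fderiv ℝ (om ∘ lieScale μ) z (1, 0) =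
      μ⁻¹ • ((fun z => fderiv ℝ om z (1, 0)) ∘ lieScale μ) z := by
    intro z hz
    rw [fderiv_comp_lieScale ((h.1.differentiableOn (by simp)).differentiableAt (hU.mem_nhds hz)),
      lieScaleL_fst, map_smul]
    rfl
  have hd' : DifferentiableAt ℝ ((fun z => fderiv ℝ om z (1, 0)) ∘ lieScale μ) y :=
    hd.comp y (lieScaleL μ).differentiableAt
  rw [fderiv_congr_of_isOpen (isOpen_preimage_lieScale hU) e1 hy, fderiv_fun_const_smul hd',
    smul_apply, fderiv_comp_lieScale hd, lieScaleL_snd, map_smul, h.2 _ hy, smul_smul,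
    inv_mul_cancel₀ hμ, one_smul]
  rfl

variable {M : Type*} [TopologicalSpace M] [ChartedSpace Plane M]
  {c : LorentzConformalStructure M} {N f : M → R3} {V : Set M}
  {e : OpenPartialHomeomorph M Plane}

theorem IsLelieuvreOn.fderiv_eq (hf : IsLelieuvreOn c N V f) (hN : IsHarmonic c N)
    (hV : IsOpen V) (he : e ∈ IsManifold.maximalAtlas 𝓘(ℝ, Plane) ∞ M) (heV : e.source ⊆ V)
    {y : Plane} (hy : y ∈ e.target) (v : Plane) :
    fderiv ℝ (f ∘ e.symm) y v =
      N (e.symm y) ⨯₃ fderiv ℝ (N ∘ e.symm) y (coordEndo c.J e y v) := by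
  have hx := heV (e.map_target hy)
  rw [hN.fderiv_coordEndo he hy, ← hf.eq _ hx]
  exact fderiv_comp_symm he hy
    (((hf.smooth _ hx).contMDiffAt (hV.mem_nhds hx)).mdifferentiableAt (by simp)) v

theorem injective_fderiv_comp_symm (hN : IsHarmonic c N)
    (he : e ∈ IsManifold.maximalAtlas 𝓘(ℝ, Plane) ∞ M) {y : Plane} (hy : y ∈ e.target)
    (hi : Function.Injective (d N (e.symm y))) : Function.Injective (fderiv ℝ (N ∘ e.symm) y) := by
  intro v w h
  rw [hN.fderiv_eq_d he hy, hN.fderiv_eq_d he hy] at h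
  have := congrArg (mfderiv 𝓘(ℝ, Plane) 𝓘(ℝ, Plane) e (e.symm y)) (hi h)
  rwa [mfderiv_mfderiv_symm he hy, mfderiv_mfderiv_symm he hy] at this

theorem IsNullChart.lelieuvre_fst (he : IsNullChart c e) (hf : IsLelieuvreOn c N V f)
    (hN : IsHarmonic c N) (hV : IsOpen V) (heV : e.source ⊆ V) {y : Plane} (hy : y ∈ e.target) :
    fderiv ℝ (f ∘ e.symm) y (1, 0) = N (e.symm y) ⨯₃ fderiv ℝ (N ∘ e.symm) y (1, 0) := by
  rw [hf.fderiv_eq hN hV he.1 heV hy, (he.2 y hy).1]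

theorem IsNullChart.lelieuvre_snd (he : IsNullChart c e) (hf : IsLelieuvreOn c N V f)
    (hN : IsHarmonic c N) (hV : IsOpen V) (heV : e.source ⊆ V) {y : Plane} (hy : y ∈ e.target) :
    fderiv ℝ (f ∘ e.symm) y (0, 1) = -(N (e.symm y) ⨯₃ fderiv ℝ (N ∘ e.symm) y (0, 1)) := by
  rw [hf.fderiv_eq hN hV he.1 heV hy, (he.2 y hy).2, map_neg, map_neg]

/-- In null coordinates `*dN = N_ξ dξ - N_η dη`, so `d*dN = -2 N_ξη dξ ∧ dη`. -/
theorem IsNullChart.cross_mixed_derivative (he : IsNullChart c e) (hN : IsHarmonic c N)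
    {y : Plane} (hy : y ∈ e.target) :
    N (e.symm y) ⨯₃ fderiv ℝ (fun z => fderiv ℝ (N ∘ e.symm) z (1, 0)) y (0, 1) = 0 := by
  have ht := hN.tension e he.1 y hy
  rw [dStarD, fderiv_congr_of_isOpen e.open_target (g := fun z => -fderiv ℝ (N ∘ e.symm) z (0, 1))
    (fun z hz => by rw [(he.2 z hz).2, map_neg]) hy, fderiv_congr_of_isOpen e.open_target
    (f := fun z => fderiv ℝ (N ∘ e.symm) z (coordEndo c.J e z (1, 0)))
    (g := fun z => fderiv ℝ (N ∘ e.symm) z (1, 0)) (fun z hz => by rw [(he.2 z hz).1]) hy,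
    fderiv_fun_neg, neg_apply,
    fderiv_fderiv_comm e.open_target (hN.contDiffOn he.1) hy (0, 1) (1, 0), ← neg_add',
    map_neg, map_add, neg_eq_zero, ← two_smul ℝ] at ht
  exact (smul_eq_zero.mp ht).resolve_left two_ne_zero

/-- The angle of Tchebyshev null coordinates solves the sine-Gordon equation. -/
theorem IsNullChart.sineGordonOn (he : IsNullChart c e) (hf : IsLelieuvreOn c N V f)
    (hN : IsHarmonic c N) (hV : IsOpen V) (heV : e.source ⊆ V) {om : Plane → ℝ}
    (hI : HasFirstFormOn e.target (f ∘ e.symm) 1 om 1)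
    (hi : ∀ x ∈ e.source, Function.Injective (d N x)) (hom : ContDiffOn ℝ ∞ om e.target) :
    SineGordonOn e.target (-1) om := by
  rw [hasFirstFormOn_iff] at hI
  have hform : ∀ y ∈ e.target,
      fderiv ℝ (N ∘ e.symm) y (1, 0) ⬝ᵥ fderiv ℝ (N ∘ e.symm) y (1, 0) = 1 ∧
      fderiv ℝ (N ∘ e.symm) y (1, 0) ⬝ᵥ fderiv ℝ (N ∘ e.symm) y (0, 1) = -Real.cos (om y) ∧
      fderiv ℝ (N ∘ e.symm) y (0, 1) ⬝ᵥ fderiv ℝ (N ∘ e.symm) y (0, 1) = 1 := by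
    intro y hy
    obtain ⟨h1, h2, h3⟩ := hI y hy
    have hdot := fun u v => cross_dot_cross_of_orthogonal (u := fderiv ℝ (N ∘ e.symm) y u)
      (hN.unit (e.symm y)) (hN.dot_fderiv he.1 hy v)
    rw [he.lelieuvre_fst hf hN hV heV hy] at h1 h2
    rw [he.lelieuvre_snd hf hN hV heV hy] at h2 h3
    simp only [dotProduct_neg, neg_dotProduct, neg_neg, hdot] at h1 h2 h3
    exact ⟨h1, by linarith, h3⟩
  have hsin : ∀ y ∈ e.target, Real.sin (om y) ≠ 0 := by
    intro y hy h0
    obtain ⟨h1, h2, h3⟩ := hform y hy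
    have hc : Real.cos (om y) ^ 2 = 1 := by
      have := Real.sin_sq_add_cos_sq (om y)
      rw [h0] at this; linarith
    -- The vector `N_ξ + cos ω N_η` has squared length `1 - cos² ω`; if `sin ω = 0` it vanishes,
    -- which contradicts the immersion.
    have hz : fderiv ℝ (N ∘ e.symm) y (1, Real.cos (om y)) = 0 := by
      apply eq_zero_of_dot_self
      have h : fderiv ℝ (N ∘ e.symm) y (1, Real.cos (om y)) = (1 : ℝ) • fderiv ℝ (N ∘ e.symm) y (1, 0)
          + Real.cos (om y) • fderiv ℝ (N ∘ e.symm) y (0, 1) :=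
        apply_eq_add (fderiv ℝ (N ∘ e.symm) y).toLinearMap (1, Real.cos (om y))
      rw [h]
      simp only [dotProduct_add, add_dotProduct, smul_dotProduct, dotProduct_smul, smul_eq_mul,
        dotProduct_comm (fderiv ℝ (N ∘ e.symm) y (0, 1)) (fderiv ℝ (N ∘ e.symm) y (1, 0)), h1, h2,
        h3]
      linarith
    have := injective_fderiv_comp_symm hN he.1 hy (hi _ (e.map_target hy)) (hz.trans (map_zero _).symm)
    exact one_ne_zero (congrArg Prod.fst this)
  refine ⟨hom, fun y hy => ?_⟩
  rw [sineGordon_of_harmonic e.open_target (hN.contDiffOn he.1) hom (fun _ _ => hN.unit _)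
    (fun y hy => (hform y hy).1) (fun y hy => (hform y hy).2.2) (fun y hy => (hform y hy).2.1)
    (fun y hy => he.cross_mixed_derivative hN hy) hsin hy]
  ring

/-- A map of the plane with `df = n × dn ∘ J`, where `J` is a constant trace-free involution, is a
`K`-surface where `n` is an immersion. -/
theorem isKSurfaceOn_plane {U : Set Plane} {f n : Plane → R3} (hf : ContDiffOn ℝ ∞ f U)
    (hn : ContDiffOn ℝ ∞ n U) {J : Plane →ₗ[ℝ] Plane} (hJ : ∀ X, J (J X) = X)
    (hJt : (J (1, 0)).1 + (J (0, 1)).2 = 0) (h1 : ∀ y ∈ U, n y ⬝ᵥ n y = 1)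
    (h0 : ∀ y ∈ U, ∀ v, n y ⬝ᵥ fderiv ℝ n y v = 0)
    (hi : ∀ y ∈ U, Function.Injective (fderiv ℝ n y))
    (h : ∀ y ∈ U, ∀ v, fderiv ℝ f y v = n y ⨯₃ fderiv ℝ n y (J v)) : IsKSurfaceOn U f n (-1) where
  neg := by norm_num
  immersed :=
    { smooth := hf.contMDiffOn
      smooth_gauss := hn.contMDiffOn
      immersion := fun y hy X Y hXY => injective_cross (D := (fderiv ℝ n y).toLinearMap) (h1 y hy)
        (h0 y hy) (hi y hy) hJ (((h y hy X).symm.trans (d_eq_fderiv f y X).symm).trans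
          (hXY.trans ((d_eq_fderiv f y Y).trans (h y hy Y))))
      unit := h1
      normal := fun y hy X => (congrArg (n y ⬝ᵥ ·) ((d_eq_fderiv f y X).trans (h y hy X))).trans
        (dot_self_cross _ _) }
  curvature := fun y hy => by
    obtain ⟨S, hS, hdet⟩ := exists_shape_operator (D := (fderiv ℝ n y).toLinearMap)
      (h1 y hy) (h0 y hy) (hi y hy) hJ hJt
    exact ⟨S, fun X => ((d_eq_fderiv f y (S X)).trans (h y hy _)).trans
      ((hS X).trans (congrArg (- ·) (d_eq_fderiv n y X).symm)), hdet⟩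

/-- In null coordinates rescaled by `lieScale`, a map `f` with `df = N × *dN` is a `K`-surface. -/
theorem IsNullChart.isKSurfaceOn_lieScale (he : IsNullChart c e) (hf : IsLelieuvreOn c N V f)
    (hN : IsHarmonic c N) (hV : IsOpen V) (heV : e.source ⊆ V)
    (hi : ∀ x ∈ e.source, Function.Injective (d N x)) {μ : ℝ} (hμ : μ ≠ 0) :
    IsKSurfaceOn (lieScale μ ⁻¹' e.target) (f ∘ e.symm ∘ lieScale μ) (N ∘ e.symm ∘ lieScale μ)
      (-1) := by
  have sN := hN.contDiffOn he.1
  have sf := contDiffOn_comp_symm he.1 hf.smooth heV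
  have dN : ∀ y ∈ lieScale μ ⁻¹' e.target, ∀ v, fderiv ℝ (N ∘ e.symm ∘ lieScale μ) y v =
      fderiv ℝ (N ∘ e.symm) (lieScale μ y) (lieScaleL μ v) := fun y hy v =>
    fderiv_comp_lieScale (g := N ∘ e.symm)
      ((sN.differentiableOn (by simp)).differentiableAt (e.open_target.mem_nhds hy)) v
  have df : ∀ y ∈ lieScale μ ⁻¹' e.target, ∀ v, fderiv ℝ (f ∘ e.symm ∘ lieScale μ) y v =
      fderiv ℝ (f ∘ e.symm) (lieScale μ y) (lieScaleL μ v) := fun y hy v =>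
    fderiv_comp_lieScale (g := f ∘ e.symm)
      ((sf.differentiableOn (by simp)).differentiableAt (e.open_target.mem_nhds hy)) v
  -- The star in null coordinates is `diag(1, -1)`, which commutes with the diagonal rescaling.
  refine isKSurfaceOn_plane (J := planeMap (1, 0) (-(0, 1))) (contDiffOn_comp_lieScale sf)
    (contDiffOn_comp_lieScale sN) (fun X => by ext <;> simp [planeMap_apply])
    (by simp [planeMap_apply]) (fun _ _ => hN.unit _) ?_ ?_ ?_
  · intro y hy v
    rw [dN y hy]
    exact hN.dot_fderiv he.1 hy _
  · intro y hy X Y h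
    rw [dN y hy, dN y hy] at h
    exact lieScaleL_injective hμ
      (injective_fderiv_comp_symm hN he.1 hy (hi _ (e.map_target hy)) h)
  · intro y hy v
    rw [df y hy, dN y hy, hf.fderiv_eq hN hV he.1 heV hy]
    have h := apply_eq_add (coordEndo c.J e (lieScale μ y)).toLinearMap (lieScaleL μ v)
    simp only [ContinuousLinearMap.coe_coe, (he.2 _ hy).1, (he.2 _ hy).2] at h
    rw [h]
    congr 2
    ext <;> simp [planeMap_apply, lieScaleL]

variable [IsManifold 𝓘(ℝ, Plane) ∞ M] {μ : ℝ} {T : M → Matrix (Fin 3) (Fin 3) ℝ} {fμ : M → R3}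

theorem IsNullChart.lelieuvre_transform (he : IsNullChart c e) (hN : IsHarmonic c N)
    (hT : IsTrivialisingGauge c N (μ : ℂ) (fun x => (T x).map Complex.ofReal))
    (hV : IsOpen V) (heV : e.source ⊆ V) (hf : IsLelieuvreOn c N V f)
    (hfμ : IsLelieuvreOn c (fun x => T x *ᵥ N x) V fμ) {y : Plane} (hy : y ∈ e.target) :
    fderiv ℝ (fμ ∘ e.symm) y (1, 0) = μ • T (e.symm y) *ᵥ fderiv ℝ (f ∘ e.symm) y (1, 0) ∧
    fderiv ℝ (fμ ∘ e.symm) y (0, 1) = μ⁻¹ • T (e.symm y) *ᵥ fderiv ℝ (f ∘ e.symm) y (0, 1) := by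
  have hNμ := hT.isHarmonic_transform hN
  rw [he.lelieuvre_fst hfμ hNμ hV heV hy, he.lelieuvre_fst hf hN hV heV hy,
    he.lelieuvre_snd hfμ hNμ hV heV hy, he.lelieuvre_snd hf hN hV heV hy,
    hT.fderiv_transform hN he.1 hy, hT.fderiv_transform hN he.1 hy, (he.2 y hy).1, (he.2 y hy).2,
    mulVec_cross (hT.real_orth _) (hT.real_det _), mulVec_cross (hT.real_orth _) (hT.real_det _),
    map_neg, ← Matrix.mulVec_smul, ← Matrix.mulVec_smul, ← Matrix.mulVec_neg]
  simp only [map_add, map_smul, map_neg]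
  constructor <;> congr 1 <;> module

theorem IsNullChart.firstForm_transform (he : IsNullChart c e) (hN : IsHarmonic c N)
    (hμ : μ ≠ 0) (hT : IsTrivialisingGauge c N (μ : ℂ) (fun x => (T x).map Complex.ofReal))
    (hV : IsOpen V) (heV : e.source ⊆ V) (hf : IsLelieuvreOn c N V f)
    (hfμ : IsLelieuvreOn c (fun x => T x *ᵥ N x) V fμ) {om : Plane → ℝ}
    (hI : HasFirstFormOn e.target (f ∘ e.symm) 1 om 1) :
    HasFirstFormOn e.target (fμ ∘ e.symm) (μ ^ 2) om ((μ ^ 2)⁻¹) := by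
  rw [hasFirstFormOn_iff] at hI ⊢
  intro y hy
  obtain ⟨h1, h2, h3⟩ := hI y hy
  obtain ⟨e1, e2⟩ := he.lelieuvre_transform hN hT hV heV hf hfμ hy
  rw [e1, e2]
  simp only [smul_dotProduct, dotProduct_smul, mulVec_dot_mulVec (hT.real_orth _), h1, h2, h3,
    smul_eq_mul]
  refine ⟨by ring, ?_, by field_simp⟩
  field_simp

theorem IsNullChart.isLieTransform (he : IsNullChart c e) (hN : IsHarmonic c N)
    (hμ : μ ≠ 0) (hT : IsTrivialisingGauge c N (μ : ℂ) (fun x => (T x).map Complex.ofReal))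
    (hV : IsOpen V) (heV : e.source ⊆ V) (hf : IsLelieuvreOn c N V f)
    (hfμ : IsLelieuvreOn c (fun x => T x *ᵥ N x) V fμ) {om : Plane → ℝ}
    (hI : HasFirstFormOn e.target (f ∘ e.symm) 1 om 1)
    (hi : ∀ x ∈ e.source, Function.Injective (d N x)) (hom : ContDiffOn ℝ ∞ om e.target) :
    IsLieTransform μ e.target (-1) om (fμ ∘ e.symm ∘ lieScale μ)
      ((fun x => T x *ᵥ N x) ∘ e.symm ∘ lieScale μ) := by
  have hNμ := hT.isHarmonic_transform hN
  have hIμ := he.firstForm_transform hN hμ hT hV heV hf hfμ hI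
  have sf := contDiffOn_comp_symm he.1 hfμ.smooth heV
  have df : ∀ y ∈ lieScale μ ⁻¹' e.target, ∀ v, fderiv ℝ (fμ ∘ e.symm ∘ lieScale μ) y v =
      fderiv ℝ (fμ ∘ e.symm) (lieScale μ y) (lieScaleL μ v) := fun y hy v =>
    fderiv_comp_lieScale (g := fμ ∘ e.symm)
      ((sf.differentiableOn (by simp)).differentiableAt (e.open_target.mem_nhds hy)) v
  have dN : ∀ y ∈ lieScale μ ⁻¹' e.target, ∀ v,
      fderiv ℝ ((fun x => T x *ᵥ N x) ∘ e.symm ∘ lieScale μ) y v =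
      fderiv ℝ ((fun x => T x *ᵥ N x) ∘ e.symm) (lieScale μ y) (lieScaleL μ v) := fun y hy v =>
    fderiv_comp_lieScale (g := (fun x => T x *ᵥ N x) ∘ e.symm)
      (((hNμ.contDiffOn he.1).differentiableOn (by simp)).differentiableAt
        (e.open_target.mem_nhds hy)) v
  have hform : HasFirstFormOn (lieScale μ ⁻¹' e.target) (fμ ∘ e.symm ∘ lieScale μ) 1
      (om ∘ lieScale μ) 1 := by
    rw [hasFirstFormOn_iff] at hIμ ⊢
    intro y hy
    obtain ⟨h1, h2, h3⟩ := hIμ _ hy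
    rw [df y hy, df y hy, lieScaleL_fst, lieScaleL_snd, map_smul, map_smul]
    simp only [smul_dotProduct, dotProduct_smul, h1, h2, h3, smul_eq_mul, Function.comp_apply]
    refine ⟨by field_simp, ?_, by field_simp⟩
    field_simp
  refine ⟨he.isKSurfaceOn_lieScale hfμ hNμ hV heV
    (fun x hx => hT.injective_d_transform hN hμ (hi x hx)) hμ, ?_, hform,
    (he.sineGordonOn hf hN hV heV hI hi hom).comp_lieScale hμ e.open_target⟩
  have hform' := hasFirstFormOn_iff.mp hform
  refine ⟨?_, ?_, ?_, ?_⟩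
  -- The coordinate lines are asymptotic because `N_ξ ⊥ N × N_ξ`, and likewise for `η`.
  · intro y hy
    rw [d_eq_fderiv, d_eq_fderiv, df y hy, dN y hy, lieScaleL_fst, map_smul, map_smul,
      he.lelieuvre_fst hfμ hNμ hV heV hy, smul_dotProduct, dotProduct_smul, dot_cross_self,
      smul_zero, smul_zero]
  · intro y hy
    rw [d_eq_fderiv, d_eq_fderiv, df y hy, dN y hy, lieScaleL_snd, map_smul, map_smul,
      he.lelieuvre_snd hfμ hNμ hV heV hy, smul_dotProduct, dotProduct_smul, dotProduct_neg,
      dot_cross_self, neg_zero, smul_zero, smul_zero]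
  · intro y hy
    rw [d_eq_fderiv]; exact (hform' y hy).1
  · intro y hy
    rw [d_eq_fderiv]; exact (hform' y hy).2.2

end LieTransform

/-! ### The identification of `ℝ³` with `so(3)`. -/

section CrossMatrix

/-- The matrix of `u ↦ v × u`. -/
noncomputable def crossMatrix (v : R3) : Matrix (Fin 3) (Fin 3) ℝ :=
  !![0, -v 2, v 1; v 2, 0, -v 0; -v 1, v 0, 0]

theorem crossMatrix_mulVec (v u : R3) : crossMatrix v *ᵥ u = v ⨯₃ u := by
  ext i
  fin_cases i <;> simp [crossMatrix, cross_apply, Matrix.vecHead, Matrix.vecTail] <;> ring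

theorem crossMatrix_transpose (v : R3) : (crossMatrix v)ᵀ = -crossMatrix v := by
  ext i j
  fin_cases i <;> fin_cases j <;> simp [crossMatrix]

theorem crossMatrix_smul (r : ℝ) (v : R3) : crossMatrix (r • v) = r • crossMatrix v := by
  ext i j
  fin_cases i <;> fin_cases j <;> simp [crossMatrix]

/-- The adjoint action of `SO(3)` is its standard action on `ℝ³`, because rotations preserve the
cross product. -/
theorem mul_crossMatrix_mul_transpose {T : Matrix (Fin 3) (Fin 3) ℝ} (h : T * Tᵀ = 1)
    (hd : T.det = 1) (v : R3) : T * crossMatrix v * Tᵀ = crossMatrix (T *ᵥ v) := by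
  refine Matrix.toLin'.injective (LinearMap.ext fun u => ?_)
  rw [Matrix.toLin'_apply, Matrix.toLin'_apply, crossMatrix_mulVec, ← Matrix.mulVec_mulVec,
    ← Matrix.mulVec_mulVec, crossMatrix_mulVec, ← mulVec_cross h hd, Matrix.mulVec_mulVec, h,
    Matrix.one_mulVec]

/-- The vector `v` with `crossMatrix v = A`, for a skew-symmetric matrix `A`. -/
noncomputable def crossVector (A : Matrix (Fin 3) (Fin 3) ℝ) : R3 := ![A 2 1, A 0 2, A 1 0]

theorem crossVector_crossMatrix (v : R3) : crossVector (crossMatrix v) = v := by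
  ext i
  fin_cases i <;> simp [crossVector, crossMatrix]

theorem toC_crossVector_cross {A : Matrix (Fin 3) (Fin 3) ℝ} (hA : Aᵀ = -A) (u : C3) :
    toC (crossVector A) ⨯₃ u = A.map Complex.ofReal *ᵥ u := by
  have h : ∀ i j, A j i = -A i j := fun i j => congrFun (congrFun hA i) j
  have h0 : ∀ i, A i i = 0 := fun i => by linarith [h i i]
  ext i
  fin_cases i <;>
    simp [toC, crossVector, cross_apply, Matrix.mulVec, dotProduct, Fin.sum_univ_three, h0,
      h 0 1, h 1 2, h 2 0] <;> ring

end CrossMatrix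

/-! ### Interchanging the parameter derivative with the space derivative. -/

section MixedDerivatives

variable {E : Type*} [NormedAddCommGroup E] [NormedSpace ℝ E] {G : ℝ × E → ℝ} {μ : ℝ} {y : E}

theorem hasDerivAt_slice (hG : DifferentiableAt ℝ G (μ, y)) :
    HasDerivAt (fun s => G (s, y)) (fderiv ℝ G (μ, y) (1, 0)) μ :=
  hG.hasFDerivAt.comp_hasDerivAt μ ((hasDerivAt_id μ).prodMk (hasDerivAt_const μ y))

theorem fderiv_slice (hG : DifferentiableAt ℝ G (μ, y)) (v : E) :
    fderiv ℝ (fun z => G (μ, z)) y v = fderiv ℝ G (μ, y) (0, v) := by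
  have h := hG.hasFDerivAt.comp y ((hasFDerivAt_const μ y).prodMk (hasFDerivAt_id y))
  exact DFunLike.congr_fun h.fderiv v

/-- Differentiation with respect to a parameter commutes with differentiation. -/
theorem fderiv_deriv_comm (hG : ContDiffAt ℝ ∞ G (μ, y)) (v : E) {g : ℝ → ℝ} {g' : ℝ}
    (hg : ∀ᶠ s in 𝓝 μ, fderiv ℝ (fun z => G (s, z)) y v = g s) (hg' : HasDerivAt g g' μ) :
    fderiv ℝ (fun z => fderiv ℝ G (μ, z) (1, 0)) y v = g' := by
  have hd : ∀ w, DifferentiableAt ℝ (fun p => fderiv ℝ G p w) (μ, y) := fun w =>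
    ((hG.fderiv_right (m := ∞) le_rfl).differentiableAt (by simp)).clm_apply
      (differentiableAt_const w)
  have h3 : ∀ᶠ s in 𝓝 μ, DifferentiableAt ℝ G (s, y) := by
    -- Smoothness is assumed at one point only; lowering it to a finite order makes it hold nearby,
    -- hence differentiability on nearby slices.
    have h := (hG.of_le (m := 1) ENat.LEInfty.out).eventually (by simp)
    have hc : Filter.Tendsto (fun s : ℝ => (s, y)) (𝓝 μ) (𝓝 (μ, y)) := by
      rw [nhds_prod_eq]; exact Filter.tendsto_id.prodMk tendsto_const_nhds
    exact (hc.eventually h).mono fun s hs => hs.differentiableAt one_ne_zero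
  have h4 : (fun s => fderiv ℝ G (s, y) (0, v)) =ᶠ[𝓝 μ] g := by
    filter_upwards [h3, hg] with s hs hgs
    rw [← fderiv_slice hs, hgs]
  rw [fderiv_slice (hd (1, 0)), fderiv_fderiv_comm_of_contDiffAt hG]
  exact ((hasDerivAt_slice (hd (0, v))).congr_of_eventuallyEq h4.symm).unique hg'

end MixedDerivatives

/-! ### Sym's formula, for real families and then for holomorphic ones. -/

section Sym

variable {M : Type*} [TopologicalSpace M] [ChartedSpace Plane M]
  {c : LorentzConformalStructure M} {N : M → R3} {μ : ℝ}

theorem hasDerivAt_gaugeVec {μ : ℝ} (hμ : μ ≠ 0) (a b : R3) :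
    HasDerivAt (fun s => gaugeVec s a b)
      (μ⁻¹ • (((μ + μ⁻¹) / 2) • b + ((μ - μ⁻¹) / 2) • a)) μ := by
  have h1 : HasDerivAt (fun s : ℝ => (s / 2) • (a + b)) (((1 : ℝ) / 2) • (a + b)) μ :=
    ((hasDerivAt_id μ).div_const 2).smul_const _
  have h2 : HasDerivAt (fun s : ℝ => (s⁻¹ / 2) • (a - b)) ((-(μ ^ 2)⁻¹ / 2) • (a - b)) μ :=
    ((hasDerivAt_inv hμ).div_const 2).smul_const _
  refine ((h1.const_add (-a)).add h2).congr_deriv ?_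
  match_scalars
  · field_simp
    ring
  · field_simp

theorem hasDerivAt_crossMatrix {w : ℝ → R3} {w' : R3} (hw : HasDerivAt w w' μ) (i j : Fin 3) :
    HasDerivAt (fun s => crossMatrix (w s) i j) (crossMatrix w' i j) μ := by
  have h := hasDerivAt_pi.mp hw
  fin_cases i <;> fin_cases j <;> simp only [crossMatrix, Matrix.of_apply, Matrix.cons_val',
    Matrix.cons_val_fin_one, Matrix.cons_val, Fin.zero_eta, Fin.mk_one, Fin.reduceFinMk]
  exacts [hasDerivAt_const _ _, (h 2).neg, h 1, h 2, hasDerivAt_const _ _, (h 0).neg, (h 1).neg,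
    h 0, hasDerivAt_const _ _]

theorem IsTrivialisingGauge.fderiv_entry {s : ℝ} {T : M → Matrix (Fin 3) (Fin 3) ℝ}
    {e : OpenPartialHomeomorph M Plane}
    (hT : IsTrivialisingGauge c N (s : ℂ) (fun x => (T x).map Complex.ofReal))
    (hN : IsHarmonic c N) (he : e ∈ IsManifold.maximalAtlas 𝓘(ℝ, Plane) ∞ M)
    {y : Plane} (hy : y ∈ e.target) (v : Plane) (i j : Fin 3) :
    fderiv ℝ (fun z => T (e.symm z) i j) y v = (T (e.symm y) * crossMatrix
      (gaugeVec s (N (e.symm y) ⨯₃ fderiv ℝ (N ∘ e.symm) y v)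
        (N (e.symm y) ⨯₃ fderiv ℝ (N ∘ e.symm) y (coordEndo c.J e y v)))) i j := by
  have h := congrFun (hT.fderiv_mulVec_const hN he hy (Pi.single j 1) v) i
  rw [← crossMatrix_mulVec, Matrix.mulVec_mulVec, ← fderiv_apply_coord
    (differentiableAt_mulVec (hT.differentiableAt_comp_symm he hy) (differentiableAt_const _))] at h
  simpa using h

/-- A family of real trivialising gauges of `d_s` for `s` near `μ`, smooth in all variables. -/
structure IsRealGaugeFamilyNear (c : LorentzConformalStructure M) (N : M → R3) (μ : ℝ)
    (T : ℝ → M → Matrix (Fin 3) (Fin 3) ℝ) : Prop where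
  gauge : ∀ᶠ s : ℝ in 𝓝 μ, IsTrivialisingGauge c N (s : ℂ) (fun x => (T s x).map Complex.ofReal)
  smooth : ∀ x i j, ContMDiffAt (𝓘(ℝ, ℝ).prod 𝓘(ℝ, Plane)) 𝓘(ℝ, ℝ) ∞
    (fun p : ℝ × M => T p.1 p.2 i j) (μ, x)

/-- The derivative of a family of matrices with respect to the parameter. -/
noncomputable def paramDeriv (μ : ℝ) (T : ℝ → M → Matrix (Fin 3) (Fin 3) ℝ) (x : M) :
    Matrix (Fin 3) (Fin 3) ℝ :=
  Matrix.of fun i j => deriv (fun s => T s x i j) μ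

/-- The real form of `symMatrix`. -/
noncomputable def realSymMatrix (μ : ℝ) (T : ℝ → M → Matrix (Fin 3) (Fin 3) ℝ) (x : M) :
    Matrix (Fin 3) (Fin 3) ℝ :=
  μ • (paramDeriv μ T x * (T μ x)ᵀ)

namespace IsRealGaugeFamilyNear

variable {T : ℝ → M → Matrix (Fin 3) (Fin 3) ℝ} (h : IsRealGaugeFamilyNear c N μ T)
  {e : OpenPartialHomeomorph M Plane}
include h

theorem gauge_self : IsTrivialisingGauge c N (μ : ℂ) (fun x => (T μ x).map Complex.ofReal) :=
  h.gauge.self_of_nhds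

theorem contDiffAt (he : e ∈ IsManifold.maximalAtlas 𝓘(ℝ, Plane) ∞ M) {y : Plane}
    (hy : y ∈ e.target) (i j : Fin 3) :
    ContDiffAt ℝ ∞ (fun p : ℝ × Plane => T p.1 (e.symm p.2) i j) (μ, y) := by
  have h1 : ContMDiffAt 𝓘(ℝ, ℝ × Plane) 𝓘(ℝ, ℝ) ∞ (fun p : ℝ × Plane => p.1) (μ, y) :=
    contDiff_fst.contMDiff _
  have h2 : ContMDiffAt 𝓘(ℝ, ℝ × Plane) 𝓘(ℝ, Plane) ∞ (fun p : ℝ × Plane => e.symm p.2) (μ, y) :=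
    ContMDiffAt.comp (μ, y) (contMDiffAt_symm_of_mem_maximalAtlas he hy)
      (contDiff_snd.contMDiff _ : ContMDiffAt 𝓘(ℝ, ℝ × Plane) 𝓘(ℝ, Plane) ∞ Prod.snd (μ, y))
  exact contMDiffAt_iff_contDiffAt.mp
    (ContMDiffAt.comp (μ, y) (h.smooth (e.symm y) i j) (h1.prodMk h2))

theorem paramDeriv_eq (he : e ∈ IsManifold.maximalAtlas 𝓘(ℝ, Plane) ∞ M) {y : Plane}
    (hy : y ∈ e.target) (i j : Fin 3) : paramDeriv μ T (e.symm y) i j =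
      fderiv ℝ (fun p : ℝ × Plane => T p.1 (e.symm p.2) i j) (μ, y) (1, 0) :=
  (hasDerivAt_slice ((h.contDiffAt he hy i j).differentiableAt (by simp))).deriv

theorem hasDerivAt [IsManifold 𝓘(ℝ, Plane) ∞ M] (x : M) (i j : Fin 3) :
    HasDerivAt (fun s => T s x i j) (paramDeriv μ T x i j) μ := by
  obtain ⟨e, he, y, hy, rfl⟩ := exists_mem_maximalAtlas x
  rw [h.paramDeriv_eq he hy]
  exact hasDerivAt_slice ((h.contDiffAt he hy i j).differentiableAt (by simp))

theorem contDiffOn_paramDeriv (he : e ∈ IsManifold.maximalAtlas 𝓘(ℝ, Plane) ∞ M) (i j : Fin 3) :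
    ContDiffOn ℝ ∞ (fun z => paramDeriv μ T (e.symm z) i j) e.target := by
  refine ContDiffOn.congr (fun y hy => ?_) fun y hy => h.paramDeriv_eq he hy i j
  have h1 := (h.contDiffAt he hy i j).fderiv_right (m := ∞) le_rfl
  have h2 : ContDiffAt ℝ ∞ (fun z : Plane => (μ, z)) y := contDiffAt_const.prodMk contDiffAt_id
  exact ((h1.comp y h2).clm_apply contDiffAt_const).contDiffWithinAt

theorem contDiffOn_realSymMatrix (he : e ∈ IsManifold.maximalAtlas 𝓘(ℝ, Plane) ∞ M)
    (i k : Fin 3) : ContDiffOn ℝ ∞ (fun z => realSymMatrix μ T (e.symm z) i k) e.target := by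
  change ContDiffOn ℝ ∞
    (fun z => μ * ∑ j, paramDeriv μ T (e.symm z) i j * T μ (e.symm z) k j) e.target
  exact contDiffOn_const.mul (ContDiffOn.sum fun j _ => (h.contDiffOn_paramDeriv he i j).mul
    (h.gauge_self.contDiffOn_comp_symm he k j))

variable [IsManifold 𝓘(ℝ, Plane) ∞ M]

/-- Differentiating `T Tᵀ = 1` in the parameter puts the logarithmic derivative in `so(3)`. -/
theorem realSymMatrix_transpose (x : M) :
    (realSymMatrix μ T x)ᵀ = -realSymMatrix μ T x := by
  have key : paramDeriv μ T x * (T μ x)ᵀ + T μ x * (paramDeriv μ T x)ᵀ = 0 := by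
    ext i k
    have h1 : HasDerivAt (fun s => ∑ j, T s x i j * T s x k j)
        (∑ j, (paramDeriv μ T x i j * T μ x k j + T μ x i j * paramDeriv μ T x k j)) μ :=
      HasDerivAt.fun_sum fun j _ => (h.hasDerivAt x i j).mul (h.hasDerivAt x k j)
    have h2 : (fun s => ∑ j, T s x i j * T s x k j) =ᶠ[𝓝 μ]
        fun _ => (1 : Matrix (Fin 3) (Fin 3) ℝ) i k := by
      filter_upwards [h.gauge] with s hs
      rw [← hs.real_orth x]; rfl
    have h3 := (h1.congr_of_eventuallyEq h2.symm).unique (hasDerivAt_const _ _)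
    rw [Finset.sum_add_distrib] at h3
    exact h3
  rw [realSymMatrix, Matrix.transpose_smul, Matrix.transpose_mul, Matrix.transpose_transpose,
    ← smul_neg, eq_neg_of_add_eq_zero_right key]

/-- The parameter derivative of `dT = T (A ×)`, by symmetry of mixed partials and the product rule.
-/
theorem fderiv_paramDeriv (hN : IsHarmonic c N) (hμ : μ ≠ 0)
    (he : e ∈ IsManifold.maximalAtlas 𝓘(ℝ, Plane) ∞ M) {y : Plane} (hy : y ∈ e.target)
    (v : Plane) (i j : Fin 3) {a b : R3} (ha : a = N (e.symm y) ⨯₃ fderiv ℝ (N ∘ e.symm) y v)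
    (hb : b = N (e.symm y) ⨯₃ fderiv ℝ (N ∘ e.symm) y (coordEndo c.J e y v)) :
    fderiv ℝ (fun z => paramDeriv μ T (e.symm z) i j) y v =
      (paramDeriv μ T (e.symm y) * crossMatrix (gaugeVec μ a b) + T μ (e.symm y) *
        crossMatrix (μ⁻¹ • (((μ + μ⁻¹) / 2) • b + ((μ - μ⁻¹) / 2) • a))) i j := by
  rw [fderiv_congr_of_isOpen e.open_target (fun z hz => h.paramDeriv_eq he hz i j) hy]
  refine fderiv_deriv_comm (h.contDiffAt he hy i j) v
    (g := fun s => (T s (e.symm y) * crossMatrix (gaugeVec s a b)) i j) ?_ ?_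
  · filter_upwards [h.gauge] with s hs
    rw [ha, hb]
    exact hs.fderiv_entry hN he hy v i j
  · have h1 : HasDerivAt (fun s => ∑ k, T s (e.symm y) i k * crossMatrix (gaugeVec s a b) k j)
        (∑ k, (paramDeriv μ T (e.symm y) i k * crossMatrix (gaugeVec μ a b) k j + T μ (e.symm y) i k
          * crossMatrix (μ⁻¹ • (((μ + μ⁻¹) / 2) • b + ((μ - μ⁻¹) / 2) • a)) k j)) μ :=
      HasDerivAt.fun_sum fun k _ => (h.hasDerivAt _ i k).mul
        (hasDerivAt_crossMatrix (hasDerivAt_gaugeVec hμ a b) k j)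
    rw [Finset.sum_add_distrib] at h1
    exact h1

theorem fderiv_realSymMatrix (hN : IsHarmonic c N) (hμ : μ ≠ 0)
    (he : e ∈ IsManifold.maximalAtlas 𝓘(ℝ, Plane) ∞ M) {y : Plane} (hy : y ∈ e.target)
    (v : Plane) (i k : Fin 3) :
    fderiv ℝ (fun z => realSymMatrix μ T (e.symm z) i k) y v =
      crossMatrix (T μ (e.symm y) *ᵥ (((μ + μ⁻¹) / 2) •
          (N (e.symm y) ⨯₃ fderiv ℝ (N ∘ e.symm) y (coordEndo c.J e y v)) +
        ((μ - μ⁻¹) / 2) • (N (e.symm y) ⨯₃ fderiv ℝ (N ∘ e.symm) y v))) i k := by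
  obtain ⟨a, ha⟩ : ∃ a, a = N (e.symm y) ⨯₃ fderiv ℝ (N ∘ e.symm) y v := ⟨_, rfl⟩
  obtain ⟨b, hb⟩ : ∃ b, b = N (e.symm y) ⨯₃ fderiv ℝ (N ∘ e.symm) y (coordEndo c.J e y v) :=
    ⟨_, rfl⟩
  rw [← ha, ← hb]
  have hT := h.gauge_self
  have dD : ∀ i j, DifferentiableAt ℝ (fun z => paramDeriv μ T (e.symm z) i j) y := fun i j =>
    ((h.contDiffOn_paramDeriv he i j).differentiableOn (by simp)).differentiableAt
      (e.open_target.mem_nhds hy)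
  have dT := hT.differentiableAt_comp_symm he hy
  have fT : ∀ i j, fderiv ℝ (fun z => T μ (e.symm z) i j) y v =
      (T μ (e.symm y) * crossMatrix (gaugeVec μ a b)) i j := fun i j => by
    rw [ha, hb]; exact hT.fderiv_entry hN he hy v i j
  have hsum : fderiv ℝ (fun z => realSymMatrix μ T (e.symm z) i k) y v =
      (μ • ((paramDeriv μ T (e.symm y) * crossMatrix (gaugeVec μ a b) + T μ (e.symm y) *
        crossMatrix (μ⁻¹ • (((μ + μ⁻¹) / 2) • b + ((μ - μ⁻¹) / 2) • a))) * (T μ (e.symm y))ᵀ +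
        paramDeriv μ T (e.symm y) * (T μ (e.symm y) * crossMatrix (gaugeVec μ a b))ᵀ)) i k := by
    have e1 : (fun z => realSymMatrix μ T (e.symm z) i k) =
        fun z => μ * ∑ j, paramDeriv μ T (e.symm z) i j * T μ (e.symm z) k j := rfl
    rw [e1, fderiv_const_mul (DifferentiableAt.fun_sum fun j _ => (dD i j).fun_mul (dT k j)),
      fderiv_fun_sum fun j _ => (dD i j).fun_mul (dT k j)]
    rw [smul_apply, sum_apply, Matrix.smul_apply, Matrix.add_apply, Matrix.mul_apply,
      Matrix.mul_apply, ← Finset.sum_add_distrib]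
    congr 1
    refine Finset.sum_congr rfl fun j _ => ?_
    rw [fderiv_fun_mul (dD i j) (dT k j), add_apply, smul_apply, smul_apply, fT,
      h.fderiv_paramDeriv hN hμ he hy v i j ha hb, Matrix.transpose_apply, Matrix.transpose_apply]
    simp only [smul_eq_mul]
    ring
  rw [hsum, Matrix.transpose_mul, crossMatrix_transpose, crossMatrix_smul]
  -- The skew `A` enters once through `D` and once, with opposite sign, through `Qᵀ`, so everything
  -- containing `D` cancels and the conjugate of `B` is left.
  have : ∀ D A B Q : Matrix (Fin 3) (Fin 3) ℝ,
      μ • ((D * A + Q * (μ⁻¹ • B)) * Qᵀ + D * (-A * Qᵀ)) = Q * B * Qᵀ := by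
    intro D A B Q
    rw [add_mul, Matrix.neg_mul, Matrix.mul_neg, Matrix.mul_assoc D A, add_neg_cancel_comm,
      Matrix.mul_smul, Matrix.smul_mul, smul_smul, mul_inv_cancel₀ hμ, one_smul]
  rw [this, mul_crossMatrix_mul_transpose (hT.real_orth _) (hT.real_det _)]

/-- **Sym's formula** for a real family of gauges. -/
theorem isLelieuvreOn (hN : IsHarmonic c N) (hμ : μ ≠ 0) :
    IsLelieuvreOn c (fun x => T μ x *ᵥ N x) Set.univ
      (fun x => crossVector (realSymMatrix μ T x)) := by
  have hT := h.gauge_self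
  have cd : ∀ e ∈ IsManifold.maximalAtlas 𝓘(ℝ, Plane) ∞ M,
      ContDiffOn ℝ ∞ ((fun x => crossVector (realSymMatrix μ T x)) ∘ e.symm) e.target := by
    intro e he
    rw [contDiffOn_pi]
    intro i
    fin_cases i
    exacts [h.contDiffOn_realSymMatrix he 2 1, h.contDiffOn_realSymMatrix he 0 2,
      h.contDiffOn_realSymMatrix he 1 0]
  have smooth : ContMDiff 𝓘(ℝ, Plane) 𝓘(ℝ, R3) ∞ (fun x => crossVector (realSymMatrix μ T x)) := by
    intro x
    obtain ⟨e, he, y, hy, rfl⟩ := exists_mem_maximalAtlas x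
    have hx := e.map_target hy
    have h1 := (cd e he).contMDiffOn.comp (contMDiffOn_of_mem_maximalAtlas he) fun p hp =>
      e.map_source hp
    refine (h1.contMDiffAt (e.open_source.mem_nhds hx)).congr_of_eventuallyEq ?_
    filter_upwards [e.open_source.mem_nhds hx] with p hp
    simp [e.left_inv hp]
  refine ⟨smooth.contMDiffOn, fun x _ X => ?_⟩
  obtain ⟨e, he, y, hy, rfl⟩ := exists_mem_maximalAtlas x
  obtain ⟨v, rfl⟩ := exists_mfderiv_symm_eq he hy X
  have h1 := fderiv_comp_symm he hy ((smooth (e.symm y)).mdifferentiableAt (by simp)) v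
  have hdiff := ((cd e he).differentiableOn (by simp)).differentiableAt (e.open_target.mem_nhds hy)
  have h2 : fderiv ℝ ((fun x => crossVector (realSymMatrix μ T x)) ∘ e.symm) y v =
      T μ (e.symm y) *ᵥ (((μ + μ⁻¹) / 2) •
          (N (e.symm y) ⨯₃ fderiv ℝ (N ∘ e.symm) y (coordEndo c.J e y v)) +
        ((μ - μ⁻¹) / 2) • (N (e.symm y) ⨯₃ fderiv ℝ (N ∘ e.symm) y v)) := by
    rw [← crossVector_crossMatrix (T μ (e.symm y) *ᵥ _)]
    ext i
    rw [← fderiv_apply_coord hdiff]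
    fin_cases i
    exacts [h.fderiv_realSymMatrix hN hμ he hy v 2 1, h.fderiv_realSymMatrix hN hμ he hy v 0 2,
      h.fderiv_realSymMatrix hN hμ he hy v 1 0]
  refine h1.symm.trans (h2.trans ?_)
  -- Evaluating `dN^μ` at `JX` exchanges the two terms of `d_transform`, matching the parameter
  -- derivative of the connection vector.
  rw [hT.d_transform hN, mulVec_cross (hT.real_orth _) (hT.real_det _), c.J_sq, map_add, map_smul,
    map_smul, map_add, map_smul, map_smul, hN.fderiv_coordEndo he hy, hN.fderiv_eq_d he hy]

end IsRealGaugeFamilyNear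

namespace IsGaugeFamilyNear

variable {𝒯 : ℂ → M → Matrix (Fin 3) (Fin 3) ℂ} (h : IsGaugeFamilyNear c N μ 𝒯)
include h

theorem isRealGaugeFamilyNear :
    IsRealGaugeFamilyNear c N μ (fun s x => (𝒯 (s : ℂ) x).map Complex.re) where
  gauge := by
    filter_upwards [Complex.continuous_ofReal.continuousAt.eventually h.gauge, h.real] with s hs hr
    convert hs using 2 with x
    ext i j
    exact Complex.ext (by simp) (by simp [hr x i j])
  smooth := fun x i j => by
    have h1 : ContMDiffAt (𝓘(ℝ, ℝ).prod 𝓘(ℝ, Plane)) (𝓘(ℝ, ℂ).prod 𝓘(ℝ, Plane)) ∞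
        (fun p : ℝ × M => ((p.1 : ℂ), p.2)) (μ, x) :=
      ((Complex.ofRealCLM.contDiff.contMDiff _).comp (μ, x) contMDiffAt_fst).prodMk contMDiffAt_snd
    have h2 := ContMDiffAt.comp (μ, x) (h.smooth x i j) h1
    exact (Complex.reCLM.contDiff.contMDiff _).comp (μ, x) h2

/-- A complex derivative may be computed along the real axis, where the entries are real; this
reduces the holomorphic family to a real one. -/
theorem deriv_eq (x : M) (i j : Fin 3) : deriv (fun l => 𝒯 l x i j) (μ : ℂ) =
    (deriv (fun s : ℝ => (𝒯 (s : ℂ) x i j).re) μ : ℝ) := by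
  have h1 := (h.holo x i j).hasDerivAt
  have h2 : HasDerivAt (fun s : ℝ => 𝒯 (s : ℂ) x i j) (deriv (fun l => 𝒯 l x i j) (μ : ℂ)) μ :=
    h1.comp_ofReal
  have h3 : HasDerivAt (fun s : ℝ => (𝒯 (s : ℂ) x i j).im)
      (deriv (fun l => 𝒯 l x i j) (μ : ℂ)).im μ :=
    Complex.imCLM.hasFDerivAt.comp_hasDerivAt μ h2
  have h4 : (fun s : ℝ => (𝒯 (s : ℂ) x i j).im) =ᶠ[𝓝 μ] fun _ => 0 :=
    h.real.mono fun s hs => hs x i j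
  have h5 := (h3.congr_of_eventuallyEq h4.symm).unique (hasDerivAt_const _ _)
  rw [h1.real_of_complex.deriv]
  exact Complex.ext (by simp) (by simp [h5])

theorem symMatrix_eq (x : M) : symMatrix μ 𝒯 x =
    (realSymMatrix μ (fun s x => (𝒯 (s : ℂ) x).map Complex.re) x).map Complex.ofReal := by
  have hg := h.gauge.self_of_nhds
  have hre : ∀ i j, ((𝒯 (μ : ℂ) x i j).re : ℂ) = 𝒯 (μ : ℂ) x i j := fun i j =>
    Complex.ext (by simp) (by simp [h.real.self_of_nhds x i j])
  rw [symMatrix, Matrix.inv_eq_right_inv (hg.orth x)]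
  ext i k
  simp [realSymMatrix, paramDeriv, Matrix.mul_apply, h.deriv_eq, hre]

end IsGaugeFamilyNear

theorem IsLelieuvreOn.eq_add_const [IsManifold 𝓘(ℝ, Plane) ∞ M] {f F : M → R3} {V : Set M}
    (hV : IsOpen V) (hVc : IsPreconnected V) (hf : IsLelieuvreOn c N V f)
    (hF : IsLelieuvreOn c N V F) : ∃ v : R3, ∀ x ∈ V, f x = F x + v := by
  rcases V.eq_empty_or_nonempty with rfl | ⟨p, hp⟩
  · exact ⟨0, fun x hx => hx.elim⟩
  have df := hf.smooth.mdifferentiableOn (by simp)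
  have dF := hF.smooth.mdifferentiableOn (by simp)
  refine ⟨f p - F p, fun x hx => ?_⟩
  have h := eq_of_d_eq_zero hV hVc (f := f - F) (df.sub dF) (fun x hx => ?_) hx hp
  · simp only [Pi.sub_apply] at h
    rw [← h]; abel
  · have h1 := ((df x hx).mdifferentiableAt (hV.mem_nhds hx)).hasMFDerivAt.sub
      ((dF x hx).mdifferentiableAt (hV.mem_nhds hx)).hasMFDerivAt
    refine ContinuousLinearMap.ext fun X => ?_
    refine (DFunLike.congr_fun h1.mfderiv X).trans ?_
    have h2 : d f x X - d F x X = 0 := by rw [hf.eq x hx, hF.eq x hx, sub_self]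
    exact h2

end Sym

end KSurf

/-! ### The main theorem. -/

theorem mainTheorem3 {M : Type*} [TopologicalSpace M] [ChartedSpace KSurf.Plane M]
    [IsManifold 𝓘(ℝ, KSurf.Plane) ∞ M]
    (c : KSurf.LorentzConformalStructure M) (N : M → KSurf.R3) (hN : KSurf.IsHarmonic c N)
    (μ : ℝ) (hμ : μ ≠ 0)
    (T : M → Matrix (Fin 3) (Fin 3) ℝ)
    (hT : KSurf.IsTrivialisingGauge c N (μ : ℂ) (fun x => (T x).map Complex.ofReal))
    (Nμ : M → KSurf.R3) (hNμ : ∀ x, Nμ x = T x *ᵥ N x) :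
    -- `N^μ` is harmonic
    KSurf.IsHarmonic c Nμ ∧
    -- so, locally, there is `f^μ` with `df^μ = N^μ × *dN^μ`
    (∀ x : M, ∃ V : Set M, IsOpen V ∧ x ∈ V ∧
      ∃ fμ : M → KSurf.R3, KSurf.IsLelieuvreOn c Nμ V fμ) ∧
    -- any such `f^μ` is, where `N` immerses, a `K`-surface with Gauss map `N^μ`, `K = -1`
    -- and conformal class of the second fundamental form equal (up to sign) to `c`
    (∀ (V : Set M) (fμ : M → KSurf.R3), IsOpen V → KSurf.IsLelieuvreOn c Nμ V fμ →
      (∀ x ∈ V, Function.Injective (KSurf.d N x)) →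
      KSurf.IsKSurfaceOn V fμ Nμ (-1) ∧
      ∀ x ∈ V, ∃ t : ℝ, t ≠ 0 ∧ ∀ X Y, KSurf.secondForm fμ Nμ x X Y = t * c.g x X Y) ∧
    -- if null coordinates `e = (ξ, η)` are Tchebyshev for the surface `f` of `N`, with angle `ω`:
    -- the first fundamental form of `f^μ`, and `f^μ` as a Lie transform of `f`
    (∀ (V : Set M) (f fμ : M → KSurf.R3) (e : OpenPartialHomeomorph M KSurf.Plane)
      (om : KSurf.Plane → ℝ), IsOpen V →
      KSurf.IsLelieuvreOn c N V f → KSurf.IsLelieuvreOn c Nμ V fμ →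
      KSurf.IsNullChart c e → e.source ⊆ V →
      KSurf.IsTchebyshevOn e.target (f ∘ e.symm) (N ∘ e.symm) →
      KSurf.HasFirstFormOn e.target (f ∘ e.symm) 1 om 1 →
      KSurf.HasFirstFormOn e.target (fμ ∘ e.symm) (μ ^ 2) om ((μ ^ 2)⁻¹) ∧
      ((∀ x ∈ e.source, Function.Injective (KSurf.d N x)) → ContDiffOn ℝ ∞ om e.target →
        KSurf.IsLieTransform μ e.target (-1) om
          (fμ ∘ e.symm ∘ KSurf.lieScale μ) (Nμ ∘ e.symm ∘ KSurf.lieScale μ))) ∧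
    -- the Sym formula
    (∀ 𝒯 : ℂ → M → Matrix (Fin 3) (Fin 3) ℂ, KSurf.IsGaugeFamilyNear c N μ 𝒯 →
      (∀ x, 𝒯 (μ : ℂ) x = (T x).map Complex.ofReal) →
      ∃ F : M → KSurf.R3,
        (∀ x (u : KSurf.C3), KSurf.toC (F x) ⨯₃ u = KSurf.symMatrix μ 𝒯 x *ᵥ u) ∧
        KSurf.IsLelieuvreOn c Nμ Set.univ F ∧
        ∀ (V : Set M) (fμ : M → KSurf.R3), IsOpen V → IsPreconnected V →
          KSurf.IsLelieuvreOn c Nμ V fμ → ∃ v : KSurf.R3, ∀ x ∈ V, fμ x = F x + v) := by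
  obtain rfl : Nμ = fun x => T x *ᵥ N x := funext hNμ
  have hNμ' := hT.isHarmonic_transform hN
  refine ⟨hNμ', hNμ'.exists_lelieuvre, ?_, ?_, ?_⟩
  · intro V fμ _ hf hi
    have hiμ := fun x hx => hT.injective_d_transform hN hμ (hi x hx)
    exact ⟨hNμ'.isKSurfaceOn hf hiμ, fun x hx => hNμ'.secondForm_conformal hf hx (hiμ x hx)⟩
  · intro V f fμ e om hV hf hfμ he heV _ hI
    exact ⟨he.firstForm_transform hN hμ hT hV heV hf hfμ hI, fun hi hom =>
      he.isLieTransform hN hμ hT hV heV hf hfμ hI hi hom⟩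
  · intro 𝒯 h𝒯 hμT
    have hre : ∀ x, (𝒯 (μ : ℂ) x).map Complex.re = T x := fun x => by
      rw [hμT x]; ext i j; simp
    have hreal := h𝒯.isRealGaugeFamilyNear
    have hF := hreal.isLelieuvreOn hN hμ
    simp only [hre] at hF
    refine ⟨_, fun x u => ?_, hF, fun V fμ hV hVc hfμ => hfμ.eq_add_const hV hVc
      ⟨hF.smooth.mono (Set.subset_univ V), fun x _ => hF.eq x (Set.mem_univ x)⟩⟩
    rw [h𝒯.symMatrix_eq]
    exact KSurf.toC_crossVector_cross (hreal.realSymMatrix_transpose x) u
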